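/- Conventions. Algorithms are deterministic multi-tape Turing machines. A time-complexity class $\mathcal C$ is given by a collection $\mathcal F$ of nondecreasing functions $f:\mathbb N\to\mathbb N$ with $f(n)\ge n$ such that for every $f\in\mathcal F$ and every integer $C\ge 1$ the function $n\mapsto C f(Cn+C)+C$ is again in $\mathcal F$; a language over a finite alphabet is in $\mathcal C$ if some machine decides it within time $f(n)$ on words of length $n$, for some $f\in\mathcal F$. A function $g$ is subexponential if $g(n)/r^n\to 0$ for every $r>1$, and SubExp is the class of languages decidable in time bounded by a subexponential function. A finite generating set of a group $G$ is a finite alphabet $A$ with a map $A\to G$ whose image generates $G$; every word over the formal alphabet $A\sqcup A^{-1}$ represents an element of $G$. For a subgroup $H\le G$ the membership problem $MP(G,H,A)$ is the language of all words over $A\sqcup A^{-1}$ that represent elements of $H$; it is said to be in a class if this holds for some finite generating set $A$ (membership in SubExp, or in a class $\mathcal C$ as above, does not depend on $A$). The Schreier coset graph of $G$ over $H$ relative to $A$ has the cosets $Hg$ as vertices and, for every coset $Hg$ and every $a\in A$, an edge from $Hg$ to $Hga$ (with a formal inverse edge). It is non-amenable if there is $\varepsilon>0$ such that every finite nonempty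 set $F$ of vertices is joined to its complement by at least $\varepsilon|F|$ edges; this property, too, is required for some finite generating set (and does not depend on it). A discrete probability measure $\mu$ on the set $X^*$ of words is length-invariant if $\mu(w)=\mu(w')$ whenever $|w|=|w'|$. Theorem C. Let $G$ be a finitely presented group, let $H\le G$ be a subgroup such that the membership problem for $H$ in $G$ is in SubExp, let $G_1\le G$ be a subgroup of finite index with $H\le G_1$, and let $\phi:G_1\to\bar G$ be an epimorphism. Let $\mathcal C\subseteq \mathrm{SubExp}$ be a time-complexity class and suppose that there is a subgroup $K$ with $\phi(H)\le K\le\bar G$ such that the Schreier coset graph of $\bar G$ over $K$ is non-amenable and the membership problem for $K$ in $\bar G$ is in $\mathcal C$. Then for every finite generating set $A$ of $G$, with $X=A\sqcup A^{-1}$, the problem $MP(G,H,A)\subseteq X^*$ is solvable with average-case time-complexity in $\mathcal C$, uniformly relative to the family of all length-invariant discrete probability measures on $X^*$. That is, there are a machine $M$ that decides $MP(G,H,A)$ and halts on every $w\in X^*$ after $T(w)<\infty$ steps, a positive nondecreasing function $f$ in the collection $\mathcal F$ of $\mathcal C$, and a constant $0<C<\infty$ such that $$\sum_{w\in X^*}\frac{T(w)}{f(|w|)}\,\mu(w)\le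 C$$ for every length-invariant discrete probability measure $\mu$ on $X^*$. -/

import Mathlib

open scoped ENNReal NNReal Topology
open Filter

universe u

/-! ### Deterministic multi-tape Turing machines -/

/-- A deterministic multi-tape Turing machine with input alphabet `α`. It has finitely many
two-way infinite tapes, indexed by `ι`, one of which is the input tape, a finite tape alphabet `Γ`
whose `default` symbol is the blank and which contains `α` as non-blank symbols, and a finite set
`Q` of working states. Depending on the working state and on the scanned symbols, one step moves
to a working state or to one of the halting states `true` ("yes") and `false` ("no"), overwrites
the scanned symbol of each tape and moves each head left, right or not at all. -/
structure MultiTapeTM (α : Type u) where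
  ι : Type
  finι : Finite ι
  inputTape : ι
  Γ : Type
  finΓ : Finite Γ
  inhΓ : Inhabited Γ
  embed : α → Γ
  embed_injective : Function.Injective embed
  embed_ne_blank : ∀ a, embed a ≠ default
  Q : Type
  finQ : Finite Q
  start : Q
  δ : Q → (ι → Γ) → (Q ⊕ Bool) × (ι → Γ × Option Turing.Dir)

namespace MultiTapeTM

variable {α : Type u} (M : MultiTapeTM α)

attribute [instance] MultiTapeTM.finι MultiTapeTM.finΓ MultiTapeTM.inhΓ MultiTapeTM.finQ

/-- A configuration: the current state and the contents of the tapes with the head positions. -/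
structure Cfg where
  state : M.Q ⊕ Bool
  tape : M.ι → Turing.Tape M.Γ

/-- The initial configuration: the input stands on the input tape, its head scans the first letter,
and all other tapes are blank. -/
noncomputable def init (w : List α) : M.Cfg where
  state := Sum.inl M.start
  tape := fun i => by
    classical exact if i = M.inputTape then Turing.Tape.mk₁ (w.map M.embed) else default

/-- The action of one tape operation: write a symbol, then move the head (or leave it). -/
def act {Γ : Type} [Inhabited Γ] (a : Γ × Option Turing.Dir) (T : Turing.Tape Γ) :
    Turing.Tape Γ :=
  match a.2 with
  | none => T.write a.1
  | some d => (T.write a.1).move d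

/-- One step of the computation; a halted configuration does not change any more. -/
def step (c : M.Cfg) : M.Cfg :=
  match c.state with
  | Sum.inr _ => c
  | Sum.inl q =>
    let a := M.δ q (fun i => (c.tape i).head)
    { state := a.1, tape := fun i => act (a.2 i) (c.tape i) }

/-- The configuration after `t` steps on input `w`. -/
noncomputable def run (w : List α) (t : ℕ) : M.Cfg := M.step^[t] (M.init w)

/-- The number of steps that `M` makes on input `w` until it halts (`⊤` if it does not halt). -/
noncomputable def time (w : List α) : ℕ∞ :=
  ⨅ (t : ℕ) (_ : ∃ b : Bool, (M.run w t).state = Sum.inr b), (t : ℕ∞)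

/-- `M` decides the language `L`: on every input it halts, in the state "yes" on the words of `L`
and in the state "no" on all other words. -/
def Decides (L : Language α) : Prop :=
  ∀ w : List α, ∃ (t : ℕ) (b : Bool), (M.run w t).state = Sum.inr b ∧ (b = true ↔ w ∈ L)

end MultiTapeTM

/-! ### Time-complexity classes -/

/-- `L` is decided by a deterministic multi-tape Turing machine in time `f`. -/
def DecidableInTime {α : Type u} (L : Language α) (f : ℕ → ℕ) : Prop :=
  ∃ M : MultiTapeTM α, M.Decides L ∧ ∀ w : List α, M.time w ≤ (f w.length : ℕ∞)

/-- A deterministic time-complexity class, given by its collection of time bounds. The bounds need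
not be constructible, so the collections of proper complexity functions are among these. -/
structure TimeClass where
  bounds : Set (ℕ → ℕ)
  monotone : ∀ f ∈ bounds, Monotone f
  le_apply : ∀ f ∈ bounds, ∀ n, n ≤ f n
  closed : ∀ f ∈ bounds, ∀ C : ℕ, 1 ≤ C → (fun n => C * f (C * n + C) + C) ∈ bounds

/-- The language `L` belongs to the time-complexity class `𝓒`. -/
def TimeClass.Contains (𝓒 : TimeClass) {α : Type u} (L : Language α) : Prop :=
  ∃ f ∈ 𝓒.bounds, DecidableInTime L f

/-- Subexponential functions. -/
def IsSubexponential (f : ℕ → ℝ) : Prop :=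
  ∀ r : ℝ, 1 < r → Tendsto (fun n => f n / r ^ n) atTop (𝓝 0)

/-- `L` is decidable in deterministic subexponential time. -/
def InSubExp {α : Type u} (L : Language α) : Prop :=
  ∃ g : ℕ → ℕ, IsSubexponential (fun n => (g n : ℝ)) ∧ DecidableInTime L g

/-- Every language (over a finite alphabet) of the class `𝓒` is in SubExp. -/
def TimeClass.SubsetSubExp (𝓒 : TimeClass) : Prop :=
  ∀ (α : Type) [Finite α] (L : Language α), 𝓒.Contains L → InSubExp L

/-! ### Average-case complexity -/

/-- A discrete probability measure on words is length-invariant if words of the same length have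
the same probability. -/
def LengthInvariant {α : Type u} (μ : PMF (List α)) : Prop :=
  ∀ w w' : List α, w.length = w'.length → μ w = μ w'

/-- `M` decides `L` with average-case time-complexity bounded by `f`, uniformly relative to the
family `R` of discrete probability measures. -/
def MultiTapeTM.SolvesOnAverage {α : Type u} (M : MultiTapeTM α) (L : Language α) (f : ℕ → ℕ)
    (R : Set (PMF (List α))) : Prop :=
  M.Decides L ∧ Monotone f ∧ (∀ n, 0 < f n) ∧
    ∃ C : ℝ≥0, 0 < C ∧ ∀ μ ∈ R,
      ∑' w : List α, (M.time w : ℝ≥0∞) / (f w.length : ℝ≥0∞) * μ w ≤ (C : ℝ≥0∞)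

/-- `L` is solvable with average-case time-complexity in `𝓒`, uniformly relative to `R`. -/
def TimeClass.ContainsOnAverage (𝓒 : TimeClass) {α : Type u} (L : Language α)
    (R : Set (PMF (List α))) : Prop :=
  ∃ M : MultiTapeTM α, ∃ f ∈ 𝓒.bounds, M.SolvesOnAverage L f R

/-! ### Groups: words, membership problems, Schreier coset graphs -/

section Groups

variable {A : Type*} {G : Type*} [Group G]

/-- `π : A → G` makes the alphabet `A` a generating set of `G`. -/
def Generates (π : A → G) : Prop := Subgroup.closure (Set.range π) = ⊤

/-- The element of `G` given by a letter of `A ⊔ A⁻¹`; `(a, true)` stands for the letter `a` and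
`(a, false)` for `a⁻¹`. -/
def letterVal (π : A → G) (x : A × Bool) : G := if x.2 then π x.1 else (π x.1)⁻¹

/-- The element of `G` represented by a word in `A ⊔ A⁻¹`. -/
def wordVal (π : A → G) (w : List (A × Bool)) : G := (w.map (letterVal π)).prod

/-- The membership problem for `H` in `G` relative to `(A, π)`: all words in `A ⊔ A⁻¹` that
represent elements of `H`. -/
def membershipProblem (π : A → G) (H : Subgroup G) : Language (A × Bool) :=
  {w | wordVal π w ∈ H}

/-- The set of right cosets `H g`. -/
abbrev RightCosets (H : Subgroup G) := Quotient (QuotientGroup.rightRel H)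

/-- Right translation of right cosets: `H g ↦ H g x`. -/
def RightCosets.translate (H : Subgroup G) (x : G) : RightCosets H → RightCosets H :=
  Quotient.map (fun g => g * x) (by
    intro a b h
    change QuotientGroup.rightRel H _ _ at h
    change QuotientGroup.rightRel H _ _
    rw [QuotientGroup.rightRel_apply] at h ⊢
    simpa [mul_assoc] using h)

/-- Oriented edges of the Schreier coset graph of `G` over `H` relative to `(A, π)`: the edge
`(v, x)` starts at the coset `v`, has the label `x ∈ A ⊔ A⁻¹` and ends at the coset `v x`. The
inverse of the edge `(v, (a, true))` is the edge `(v a, (a, false))`. -/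
abbrev SchreierEdge (H : Subgroup G) (A : Type*) := RightCosets H × (A × Bool)

/-- The end vertex of an edge of the Schreier coset graph. -/
def SchreierEdge.terminus (π : A → G) {H : Subgroup G} (e : SchreierEdge H A) : RightCosets H :=
  RightCosets.translate H (letterVal π e.2) e.1

/-- The edges of the Schreier coset graph that lead from `F` to its complement. -/
def schreierBoundary (π : A → G) {H : Subgroup G} (F : Set (RightCosets H)) :
    Set (SchreierEdge H A) :=
  {e | e.1 ∈ F ∧ SchreierEdge.terminus π e ∉ F}

/-- The Schreier coset graph of `G` over `H` relative to `(A, π)` is non-amenable: its isoperimetric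
constant is positive (the Følner condition fails). -/
def SchreierNonamenable (π : A → G) (H : Subgroup G) : Prop :=
  ∃ ε : ℝ, 0 < ε ∧ ∀ F : Set (RightCosets H), F.Finite → F.Nonempty →
    ε * (F.ncard : ℝ) ≤ ((schreierBoundary π F).ncard : ℝ)

end Groups

/-- The membership problem for `H` in `G` is in SubExp (relative to some finite generating set). -/
def MembershipInSubExp {G : Type*} [Group G] (H : Subgroup G) : Prop :=
  ∃ (n : ℕ) (π : Fin n → G), Generates π ∧ InSubExp (membershipProblem π H)

/-- The membership problem for `H` in `G` is in the class `𝓒` (relative to some finite generating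
set). -/
def MembershipIn (𝓒 : TimeClass) {G : Type*} [Group G] (H : Subgroup G) : Prop :=
  ∃ (n : ℕ) (π : Fin n → G), Generates π ∧ 𝓒.Contains (membershipProblem π H)

/-- The Schreier coset graph of the finitely generated group `G` over `H` is non-amenable (for some
finite generating set). -/
def HasNonamenableSchreierGraph {G : Type*} [Group G] (H : Subgroup G) : Prop :=
  ∃ (n : ℕ) (π : Fin n → G), Generates π ∧ SchreierNonamenable π H

/-! Let `P ≤ G` be the preimage of `K` under `φ`, regarded as a subgroup of `G`; since `φ(H) ≤ K`,
it contains `H`. Testing `w ∈ P` is cheap: follow the coset of `G₁`, rewrite `w` letter by letter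
(Reidemeister–Schreier), apply `φ`, and run the machine for `K`. If the test fails, `w` is rejected
within a bound of `𝓒`. Only words representing elements of `P` are passed on to the slow machine for
`H`, and these are exponentially rare, so that they contribute a bounded amount to the average.

Rarity: non-amenability of the Schreier graph of `K` says that `Gbar ⧸ K` expands. Expansion passes
to `G ⧸ P`, which is fibred over the finite set `G ⧸ G₁` with fibres that embed in `Gbar ⧸ K`
(`Expands.of_finiteIndex`), and to the generating set `A` (`Expands.of_generates`). A Cheeger
argument bounds the `ℓ²` growth of iterates of the adjacency operator strictly below the degree
(`Expands.exists_sum_sq_le`). Words in `P` are those fixing the base point of `G ⧸ P`, so among the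
`d ^ n` words of length `n` at most `ρ ^ n * d ^ n` of them lie in `P`, with `ρ < 1`
(`Expands.exists_wordCount_le`).

The time for `H` on rewritten words of length at most `k * n` is subexponential, hence at most `B *
ρ⁻¹ ^ n`. The quotient of running time and bound therefore averages to at most `1 + B` over each
sphere, and a length-invariant measure is a mixture of uniform measures on spheres
(`LengthInvariant.tsum_mul_le`). The machine is built in `exists_machine_transduce`; its transducer
reads from right to left because `G` acts on left cosets from the left. -/

/-! ### Halting times -/

namespace MultiTapeTM

theorem time_le_of_halt {α : Type u} (M : MultiTapeTM α) {w : List α} {t : ℕ} {b : Bool}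
    (h : (M.run w t).state = Sum.inr b) : M.time w ≤ t :=
  iInf₂_le t ⟨b, h⟩

theorem step_eq_self_of_halt {α : Type u} (M : MultiTapeTM α) {c : M.Cfg} {b : Bool}
    (h : c.state = Sum.inr b) : M.step c = c := by
  simp [step, h]

theorem run_eq_of_halt {α : Type u} (M : MultiTapeTM α) {w : List α} {s t : ℕ} {b : Bool}
    (h : (M.run w s).state = Sum.inr b) (hst : s ≤ t) : M.run w t = M.run w s := by
  obtain ⟨k, rfl⟩ := Nat.exists_eq_add_of_le hst
  rw [run, add_comm, Function.iterate_add_apply]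
  exact Function.iterate_fixed (M.step_eq_self_of_halt h) k

/-- A machine that decides `L` reaches its verdict after exactly `M.time w` steps. -/
theorem Decides.exists_halt {α : Type u} {M : MultiTapeTM α} {L : Language α} (h : M.Decides L)
    (w : List α) :
    ∃ (t : ℕ) (b : Bool), M.time w = t ∧ (M.run w t).state = Sum.inr b ∧ (b = true ↔ w ∈ L) := by
  classical
  obtain ⟨t₀, b₀, h₀, hb₀⟩ := h w
  have hex : ∃ t, ∃ b : Bool, (M.run w t).state = Sum.inr b := ⟨t₀, b₀, h₀⟩
  obtain ⟨b, hb⟩ := Nat.find_spec hex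
  refine ⟨Nat.find hex, b, le_antisymm (M.time_le_of_halt hb) ?_, hb, ?_⟩
  · exact le_iInf₂ fun t ht => by exact_mod_cast Nat.find_min' hex ht
  · have := M.run_eq_of_halt hb (Nat.find_min' hex ⟨b₀, h₀⟩)
    rw [this, hb] at h₀
    rwa [Sum.inr_injective h₀]

end MultiTapeTM

/-! ### Right-to-left transducers -/

/-- The final state and the output of a finite-state transducer that reads its input from right
to left. -/
def transduce {α : Type*} {S β : Type*} (next : α → S → S) (out : α → S → List β) (s₀ : S) :
    List α → S × List β
  | [] => (s₀, [])
  | x :: w =>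
    let p := transduce next out s₀ w
    (next x p.1, out x p.1 ++ p.2)

theorem length_transduce_le {α : Type*} {S β : Type*} {next : α → S → S} {out : α → S → List β}
    {s₀ : S} {k : ℕ} (hk : ∀ x s, (out x s).length ≤ k) (w : List α) :
    (transduce next out s₀ w).2.length ≤ k * w.length := by
  induction w with
  | nil => simp [transduce]
  | cons x w ih =>
    simp only [transduce, List.length_append, List.length_cons]
    have := hk x (transduce next out s₀ w).1
    nlinarith

/-- The state never depends on what is written, so several outputs can share one run of the control.
-/
theorem transduce_fst_eq {α : Type*} {S β γ : Type*} {next : α → S → S} (out : α → S → List β)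
    (out' : α → S → List γ) {s₀ : S} (w : List α) :
    (transduce next out s₀ w).1 = (transduce next out' s₀ w).1 := by
  induction w with
  | nil => rfl
  | cons x w ih => simp [transduce, ih]

theorem filterMap_transduce {α : Type*} {S β γ : Type*} {next : α → S → S} {out : α → S → List β}
    {s₀ : S} (g : β → Option γ) (w : List α) :
    (transduce next out s₀ w).2.filterMap g =
      (transduce next (fun x s => (out x s).filterMap g) s₀ w).2 := by
  induction w with
  | nil => rfl
  | cons x w ih =>
    simp [transduce, ih, transduce_fst_eq out (fun x s => (out x s).filterMap g)]

/-! ### A transducer followed by two machines -/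

namespace Pipeline

open MultiTapeTM Turing

/-- The control states: going to the right end of the input, transducing it from right to left
(with the symbols still to be written in the current step), and running the two machines. -/
inductive State (S P Q₁ Q₂ : Type) where
  | seek : State S P Q₁ Q₂
  | emit : S → P → State S P Q₁ Q₂
  | first : Q₁ → State S P Q₁ Q₂
  | second : Q₂ → State S P Q₁ Q₂

instance {S P Q₁ Q₂ : Type} [Finite S] [Finite P] [Finite Q₁] [Finite Q₂] :
    Finite (State S P Q₁ Q₂) := by
  let f : State S P Q₁ Q₂ → Unit ⊕ (S × P) ⊕ Q₁ ⊕ Q₂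
    | .seek => .inl ()
    | .emit s p => .inr (.inl (s, p))
    | .first q => .inr (.inr (.inl q))
    | .second q => .inr (.inr (.inr q))
  refine Finite.of_injective f ?_
  rintro (_ | _ | _ | _) (_ | _ | _ | _) h <;> simp_all [f]

/-- Words of length at most `k`. -/
abbrev ShortWord (β : Type) (k : ℕ) := {l : List β // l.length ≤ k}

instance {β : Type} [Finite β] (k : ℕ) : Finite (ShortWord β k) :=
  List.finite_length_le β k

/-- The data of a transducer from `α` to `β₁ ⊕ β₂`, whose two output words serve as inputs of the
machines `M₁` and `M₂`. -/
structure Data (α : Type u) (β₁ β₂ : Type) where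
  M₁ : MultiTapeTM β₁
  M₂ : MultiTapeTM β₂
  S : Type
  finS : Finite S
  s₀ : S
  next : α → S → S
  k : ℕ
  out : α → S → List (β₁ ⊕ β₂)
  length_out_le : ∀ x s, (out x s).length ≤ k
  acc : S → Bool

variable {α : Type u} {β₁ β₂ : Type} (D : Data α β₁ β₂)

namespace Data

attribute [instance] Data.finS

/-- The control states of the combined machine. -/
abbrev Q := State D.S (ShortWord (β₁ ⊕ β₂) D.k) D.M₁.Q D.M₂.Q

/-- The verdict of `M₁`: the second machine is started if it is positive. -/
def afterFirst : D.M₁.Q ⊕ Bool → D.Q ⊕ Bool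
  | Sum.inl q => Sum.inl (State.first q)
  | Sum.inr true => Sum.inl (State.second D.M₂.start)
  | Sum.inr false => Sum.inr false

/-- The verdict of `M₂` is the verdict of the combined machine. -/
def afterSecond : D.M₂.Q ⊕ Bool → D.Q ⊕ Bool
  | Sum.inl q => Sum.inl (State.second q)
  | Sum.inr b => Sum.inr b

open Classical in
/-- The operation on a family of tapes that acts by `a` on the tape `i₀` and leaves all other tapes
unchanged. -/
noncomputable def opAt {ι Γ : Type} (sym : ι → Γ) (i₀ : ι) (a : Γ × Option Dir) :
    ι → Γ × Option Dir :=
  Function.update (fun i => (sym i, none)) i₀ a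

/-- The action on the tapes of `M₁` when the symbol `z` is written. -/
noncomputable def write₁ (sym : D.M₁.ι → D.M₁.Γ) (z : β₁ ⊕ β₂) : D.M₁.ι → D.M₁.Γ × Option Dir :=
  match z with
  | Sum.inl y => opAt sym D.M₁.inputTape (D.M₁.embed y, some Dir.left)
  | Sum.inr _ => fun i => (sym i, none)

/-- The action on the tapes of `M₂` when the symbol `z` is written. -/
noncomputable def write₂ (sym : D.M₂.ι → D.M₂.Γ) (z : β₁ ⊕ β₂) : D.M₂.ι → D.M₂.Γ × Option Dir :=
  match z with
  | Sum.inl _ => fun i => (sym i, none)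
  | Sum.inr y => opAt sym D.M₂.inputTape (D.M₂.embed y, some Dir.left)

/-- The transition function, with separate alphabets for the read-only input tape, for the tapes
of `M₁` and for those of `M₂`. -/
noncomputable def trans (q : D.Q) (x : Option α) (sym₁ : D.M₁.ι → D.M₁.Γ)
    (sym₂ : D.M₂.ι → D.M₂.Γ) :
    (D.Q ⊕ Bool) × Option Dir × (D.M₁.ι → D.M₁.Γ × Option Dir) ×
      (D.M₂.ι → D.M₂.Γ × Option Dir) :=
  match q with
  | State.seek =>
    match x with
    | some _ => (Sum.inl State.seek, some Dir.right, fun i => (sym₁ i, none),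
        fun i => (sym₂ i, none))
    | none => (Sum.inl (State.emit D.s₀ ⟨[], Nat.zero_le _⟩), some Dir.left,
        fun i => (sym₁ i, none), fun i => (sym₂ i, none))
  | State.emit s ⟨[], _⟩ =>
    match x with
    | some x => (Sum.inl (State.emit (D.next x s)
        -- The output word grows to the left, hence the block of each letter is written last symbol
        -- first.
        ⟨(D.out x s).reverse, by simpa using D.length_out_le x s⟩), some Dir.left,
        fun i => (sym₁ i, none), fun i => (sym₂ i, none))
    -- The blank marks the left end of the input. Both output heads stand one cell to the left of
    -- their words and are moved back to the first letters.
    | none => (if D.acc s then Sum.inl (State.first D.M₁.start) else Sum.inr false, none,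
        opAt sym₁ D.M₁.inputTape (sym₁ D.M₁.inputTape, some Dir.right),
        opAt sym₂ D.M₂.inputTape (sym₂ D.M₂.inputTape, some Dir.right))
  | State.emit s ⟨z :: p, h⟩ =>
    (Sum.inl (State.emit s ⟨p, (Nat.le_succ _).trans h⟩), none, D.write₁ sym₁ z, D.write₂ sym₂ z)
  | State.first q =>
    (D.afterFirst (D.M₁.δ q sym₁).1, none, (D.M₁.δ q sym₁).2, fun i => (sym₂ i, none))
  | State.second q =>
    (D.afterSecond (D.M₂.δ q sym₂).1, none, fun i => (sym₁ i, none), (D.M₂.δ q sym₂).2)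

/-- The configurations of the combined machine, with separate alphabets. -/
@[ext]
structure Conf where
  state : D.Q ⊕ Bool
  input : Tape (Option α)
  tape₁ : D.M₁.ι → Tape D.M₁.Γ
  tape₂ : D.M₂.ι → Tape D.M₂.Γ

/-- Move the head of a tape, or leave it. -/
def move {Γ : Type*} [Inhabited Γ] (d : Option Dir) (T : Tape Γ) : Tape Γ :=
  match d with
  | none => T
  | some d => T.move d

/-- One step of the combined machine, with separate alphabets. -/
noncomputable def confStep (c : D.Conf) : D.Conf :=
  match c.state with
  | Sum.inr _ => c
  | Sum.inl q =>
    let a := D.trans q c.input.head (fun i => (c.tape₁ i).head) (fun i => (c.tape₂ i).head)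
    { state := a.1
      input := move a.2.1 c.input
      tape₁ := fun i => act (a.2.2.1 i) (c.tape₁ i)
      tape₂ := fun i => act (a.2.2.2 i) (c.tape₂ i) }

variable [Finite α]

/-- The combined machine: a transducer, followed by `M₁` and, if `M₁` says "yes", by `M₂`. -/
noncomputable def machine : MultiTapeTM α :=
  have : Finite β₁ := Finite.of_injective _ D.M₁.embed_injective
  have : Finite β₂ := Finite.of_injective _ D.M₂.embed_injective
  { ι := Option (D.M₁.ι ⊕ D.M₂.ι)
    finι := inferInstance
    inputTape := none
    -- The letters are encoded by `Fin` because tape alphabets live in `Type`, while `α` may live in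
    -- a higher universe.
    Γ := Option (Fin (Nat.card α)) × D.M₁.Γ × D.M₂.Γ
    finΓ := inferInstance
    inhΓ := ⟨(none, default, default)⟩
    embed := fun x => (some (Finite.equivFin α x), default, default)
    embed_injective := fun x y h => by simpa using h
    embed_ne_blank := fun x h => by cases h
    Q := D.Q
    finQ := inferInstance
    start := State.seek
    δ := fun q sym =>
      let a := D.trans q ((sym none).1.map (Finite.equivFin α).symm)
        (fun i => (sym (some (Sum.inl i))).2.1) (fun i => (sym (some (Sum.inr i))).2.2)
      (a.1, fun i =>
        match i with
        | none => (sym none, a.2.1)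
        | some (Sum.inl i) => ((none, (a.2.2.1 i).1, default), (a.2.2.1 i).2)
        | some (Sum.inr i) => ((none, default, (a.2.2.2 i).1), (a.2.2.2 i).2)) }

/-- The projection of the tape alphabet to the input letters. -/
noncomputable def projInput : PointedMap D.machine.Γ (Option α) :=
  ⟨fun g : Option (Fin (Nat.card α)) × D.M₁.Γ × D.M₂.Γ => g.1.map (Finite.equivFin α).symm, rfl⟩

/-- The projection of the tape alphabet to the alphabet of `M₁`. -/
noncomputable def proj₁ : PointedMap D.machine.Γ D.M₁.Γ :=
  ⟨fun g : Option (Fin (Nat.card α)) × D.M₁.Γ × D.M₂.Γ => g.2.1, rfl⟩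

/-- The projection of the tape alphabet to the alphabet of `M₂`. -/
noncomputable def proj₂ : PointedMap D.machine.Γ D.M₂.Γ :=
  ⟨fun g : Option (Fin (Nat.card α)) × D.M₁.Γ × D.M₂.Γ => g.2.2, rfl⟩

/-- The configuration with separate alphabets that belongs to a configuration. -/
noncomputable def view (c : D.machine.Cfg) : D.Conf where
  state := c.state
  input := (c.tape (none : Option (D.M₁.ι ⊕ D.M₂.ι))).map D.projInput
  tape₁ := fun i => (c.tape (some (Sum.inl i) : Option (D.M₁.ι ⊕ D.M₂.ι))).map D.proj₁
  tape₂ := fun i => (c.tape (some (Sum.inr i) : Option (D.M₁.ι ⊕ D.M₂.ι))).map D.proj₂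

end Data

theorem map_act {Γ Γ' : Type} [Inhabited Γ] [Inhabited Γ'] (f : PointedMap Γ Γ')
    (a : Γ × Option Dir) (T : Tape Γ) : (act a T).map f = act (f a.1, a.2) (T.map f) := by
  obtain ⟨g, _ | d⟩ := a
  · simp [act, Tape.map_write]
  · simp [act, Tape.map_write, Tape.map_move]

theorem act_head_none {Γ : Type} [Inhabited Γ] (T : Tape Γ) : act (T.head, none) T = T := by
  simp [act]

theorem map_act_head {Γ : Type} {Γ' : Type*} [Inhabited Γ] [Inhabited Γ'] (f : PointedMap Γ Γ')
    (d : Option Dir) (T : Tape Γ) : (act (T.head, d) T).map f = Data.move d (T.map f) := by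
  obtain _ | d := d
  · simp [act, Data.move]
  · simp [act, Data.move, Tape.map_move]

variable [Finite α]

/-- The projections of the product alphabet send blank to blank, so they commute with writing and
moving. All further reasoning can take place with separate alphabets. -/
theorem view_step (c : D.machine.Cfg) : D.view (D.machine.step c) = D.confStep (D.view c) := by
  obtain ⟨q | b, T⟩ := c
  · ext1
    · simp only [Data.view, Data.confStep, step, Tape.map_fst]
      rfl
    · simp only [Data.view, Data.confStep, step, Tape.map_fst]
      exact map_act_head _ _ _
    · funext i
      simp only [Data.view, Data.confStep, step, Tape.map_fst]
      exact map_act _ _ _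
    · funext i
      simp only [Data.view, Data.confStep, step, Tape.map_fst]
      exact map_act _ _ _
  · rfl

theorem view_init (w : List α) :
    D.view (D.machine.init w) =
      ⟨Sum.inl State.seek, Tape.mk₁ (w.map some), fun _ => default, fun _ => default⟩ := by
  ext1
  · rfl
  · have : (D.machine.init w).tape (none : Option (D.M₁.ι ⊕ D.M₂.ι)) =
        Tape.mk₁ (w.map D.machine.embed) := if_pos rfl
    simp only [Data.view]
    rw [this, Tape.map_mk₁, List.map_map]
    congr 2
    funext x
    simp [Data.projInput, Data.machine]
  · funext i
    have : (D.machine.init w).tape (some (Sum.inl i) : Option (D.M₁.ι ⊕ D.M₂.ι)) = default :=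
      if_neg (by rintro ⟨⟩)
    simp only [Data.view]
    rw [this]
    rfl
  · funext i
    have : (D.machine.init w).tape (some (Sum.inr i) : Option (D.M₁.ι ⊕ D.M₂.ι)) = default :=
      if_neg (by rintro ⟨⟩)
    simp only [Data.view]
    rw [this]
    rfl

theorem view_run (w : List α) (t : ℕ) :
    D.view (D.machine.run w t) = D.confStep^[t]
      ⟨Sum.inl State.seek, Tape.mk₁ (w.map some), fun _ => default, fun _ => default⟩ := by
  rw [← view_init, run]
  exact Function.Semiconj.iterate_right (f := D.view) (view_step D) t (D.machine.init w)

end Pipeline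

/-! ### Runs of the combined machine -/

namespace Pipeline

open MultiTapeTM Turing

theorem init_tape {α : Type u} (M : MultiTapeTM α) (w : List α) :
    (M.init w).tape = open Classical in
      Function.update (fun _ => default) M.inputTape (Tape.mk₁ (w.map M.embed)) := by
  funext i
  by_cases h : i = M.inputTape
  · subst h; simp [init]
  · simp [init, h]

open Classical in
/-- The initial tapes of `M` on the input `w`, with the head of the input tape moved to the left. -/
noncomputable def shifted {α : Type u} (M : MultiTapeTM α) (w : List α) : M.ι → Tape M.Γ :=
  Function.update (fun _ => default) M.inputTape ((Tape.mk₁ (w.map M.embed)).move Dir.left)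

theorem shifted_nil {α : Type u} (M : MultiTapeTM α) : shifted M [] = fun _ => default := by
  have : (Tape.mk₁ ([] : List M.Γ)).move Dir.left = default := by
    rw [Tape.mk₁, Tape.mk₂, Tape.move_left_mk', ListBlank.tail_mk, ListBlank.head_mk,
      ListBlank.cons_mk]
    change Tape.mk' _ _ = Tape.mk' (ListBlank.mk []) (ListBlank.mk [])
    congr 1
    exact Quotient.sound' (Or.inr ⟨1, rfl⟩)
  simp [shifted, this]

open Classical in
theorem act_opAt {ι Γ : Type} [Inhabited Γ] (T : ι → Tape Γ) (i₀ : ι) (a : Γ × Option Dir) :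
    (fun i => act (Data.opAt (fun i => (T i).head) i₀ a i) (T i)) =
      Function.update T i₀ (act a (T i₀)) := by
  funext i
  by_cases h : i = i₀
  · subst h; simp [Data.opAt]
  · simp [Data.opAt, h, act_head_none]

theorem act_write_shifted {α : Type u} (M : MultiTapeTM α) (w : List α) (y : α) :
    (fun i => act (Data.opAt (fun i => (shifted M w i).head) M.inputTape
      (M.embed y, some Dir.left) i) (shifted M w i)) = shifted M (y :: w) := by
  rw [act_opAt]
  simp only [shifted, Function.update_idem, Function.update_self]
  congr 1
  simp [act, Tape.mk₁, Tape.mk₂, Tape.write_mk']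

/-- The final move to the right undoes the surplus move to the left, so each machine starts exactly
in its initial configuration. -/
theorem act_right_shifted {α : Type u} (M : MultiTapeTM α) (w : List α) :
    (fun i => act (Data.opAt (fun i => (shifted M w i).head) M.inputTape
      ((shifted M w M.inputTape).head, some Dir.right) i) (shifted M w i)) = (M.init w).tape := by
  rw [act_opAt, init_tape]
  simp [shifted, Function.update_idem, act]

variable {α : Type u} {β₁ β₂ : Type} (D : Data α β₁ β₂)

/-- The input word of the first machine that is encoded by an output of the transducer. -/
abbrev word₁ (o : List (β₁ ⊕ β₂)) : List β₁ := o.filterMap Sum.getLeft?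

/-- The input word of the second machine that is encoded by an output of the transducer. -/
abbrev word₂ (o : List (β₁ ⊕ β₂)) : List β₂ := o.filterMap Sum.getRight?

/-- The configuration while the transducer is working: it is in the state `s`, the symbols `p` are
still to be written, and `o` has been written so far. -/
noncomputable def emitConf (s : D.S) (p : ShortWord (β₁ ⊕ β₂) D.k) (T : Tape (Option α))
    (o : List (β₁ ⊕ β₂)) : D.Conf :=
  ⟨Sum.inl (State.emit s p), T, shifted D.M₁ (word₁ o), shifted D.M₂ (word₂ o)⟩

theorem confStep_seek_some (x : α) (L R : List (Option α)) (T₁ T₂) :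
    D.confStep ⟨Sum.inl State.seek, Tape.mk₂ L (some x :: R), T₁, T₂⟩ =
      ⟨Sum.inl State.seek, Tape.mk₂ (some x :: L) R, T₁, T₂⟩ := by
  simp [Data.confStep, Data.trans, Tape.mk₂, act_head_none, Data.move]

theorem confStep_seek_none (L : List (Option α)) (T₁ T₂) :
    D.confStep ⟨Sum.inl State.seek, Tape.mk₂ L [], T₁, T₂⟩ =
      ⟨Sum.inl (State.emit D.s₀ ⟨[], Nat.zero_le _⟩), (Tape.mk₂ L []).move Dir.left, T₁, T₂⟩ := by
  have hh : (Tape.mk₂ L ([] : List (Option α))).head = none := rfl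
  simp only [Data.confStep, hh, Data.trans, act_head_none, Data.move]

theorem iterate_seek (R : List α) (L : List (Option α)) (T₁ T₂) :
    D.confStep^[R.length] ⟨Sum.inl State.seek, Tape.mk₂ L (R.map some), T₁, T₂⟩ =
      ⟨Sum.inl State.seek, Tape.mk₂ ((R.map some).reverse ++ L) [], T₁, T₂⟩ := by
  induction R generalizing L with
  | nil => rfl
  | cons x R ih =>
    rw [List.length_cons, Function.iterate_succ_apply, List.map_cons, confStep_seek_some, ih]
    simp

theorem confStep_emit_cons (s : D.S) (z : β₁ ⊕ β₂) (p : List (β₁ ⊕ β₂)) (h) (T o) :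
    D.confStep (emitConf D s ⟨z :: p, h⟩ T o) =
      emitConf D s ⟨p, (Nat.le_succ _).trans h⟩ T (z :: o) := by
  obtain y | y := z
  · simp only [emitConf, Data.confStep, Data.trans, Data.write₁, Data.write₂, act_head_none,
      act_write_shifted]
    rfl
  · simp only [emitConf, Data.confStep, Data.trans, Data.write₁, Data.write₂, act_head_none,
      act_write_shifted]
    rfl

theorem iterate_emit (s : D.S) (p : List (β₁ ⊕ β₂)) (h : p.length ≤ D.k) (T o) :
    D.confStep^[p.length] (emitConf D s ⟨p, h⟩ T o) =
      emitConf D s ⟨[], Nat.zero_le _⟩ T (p.reverse ++ o) := by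
  induction p generalizing o with
  | nil => rfl
  | cons z p ih =>
    rw [List.length_cons, Function.iterate_succ_apply, confStep_emit_cons, ih]
    simp

theorem confStep_emit_nil_some (s : D.S) (h) (x : α) (L R : List (Option α)) (o) :
    D.confStep (emitConf D s ⟨[], h⟩ ((Tape.mk₂ (some x :: L) R).move Dir.left) o) =
      emitConf D (D.next x s) ⟨(D.out x s).reverse, by simpa using D.length_out_le x s⟩
        ((Tape.mk₂ L (some x :: R)).move Dir.left) o := by
  simp [emitConf, Data.confStep, Data.trans, Tape.mk₂, act_head_none, Data.move]

theorem confStep_emit_nil_none (s : D.S) (h) (R : List (Option α)) (o) :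
    D.confStep (emitConf D s ⟨[], h⟩ ((Tape.mk₂ [] R).move Dir.left) o) =
      ⟨if D.acc s then Sum.inl (State.first D.M₁.start) else Sum.inr false,
        (Tape.mk₂ [] R).move Dir.left, (D.M₁.init (word₁ o)).tape, (D.M₂.init (word₂ o)).tape⟩ := by
  have hh : ((Tape.mk₂ ([] : List (Option α)) R).move Dir.left).head = none := by
    simp [Tape.mk₂]; rfl
  simp only [emitConf, Data.confStep, hh, Data.trans, act_right_shifted, Data.move]

/-- The configuration of the transducer that has processed `u` and has still to read the reverse
of `L`. -/
noncomputable def midConf (L u : List α) : D.Conf :=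
  emitConf D (transduce D.next D.out D.s₀ u).1 ⟨[], Nat.zero_le _⟩
    ((Tape.mk₂ (L.map some) (u.map some)).move Dir.left) (transduce D.next D.out D.s₀ u).2

/-- Each letter costs one step to read and at most `D.k` steps to emit its block. -/
theorem exists_iterate_midConf (L u : List α) :
    ∃ t ≤ (D.k + 1) * L.length,
      D.confStep^[t] (midConf D L u) = midConf D [] (L.reverse ++ u) := by
  induction L generalizing u with
  | nil => exact ⟨0, by simp, rfl⟩
  | cons x L ih =>
    obtain ⟨t, ht, h⟩ := ih (x :: u)
    have h1 : D.confStep^[(D.out x (transduce D.next D.out D.s₀ u).1).length]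
        (D.confStep (midConf D (x :: L) u)) = midConf D L (x :: u) := by
      rw [midConf, List.map_cons, confStep_emit_nil_some]
      have := iterate_emit D (D.next x (transduce D.next D.out D.s₀ u).1)
        (D.out x (transduce D.next D.out D.s₀ u).1).reverse
        (by simpa using D.length_out_le x _)
        ((Tape.mk₂ (L.map some) (some x :: u.map some)).move Dir.left)
        (transduce D.next D.out D.s₀ u).2
      simp only [List.length_reverse, List.reverse_reverse] at this
      exact this
    refine ⟨t + (D.out x (transduce D.next D.out D.s₀ u).1).length + 1, ?_, ?_⟩
    · have := D.length_out_le x (transduce D.next D.out D.s₀ u).1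
      rw [List.length_cons]
      linarith
    · rw [Function.iterate_succ_apply, Function.iterate_add_apply, h1, h]
      simp

/-- The transducer reaches the end of its input in linear time. -/
theorem exists_iterate_transduce (w : List α) :
    ∃ t ≤ (D.k + 2) * (w.length + 1), ∃ T,
      D.confStep^[t]
        ⟨Sum.inl State.seek, Tape.mk₁ (w.map some), fun _ => default, fun _ => default⟩ =
      ⟨if D.acc (transduce D.next D.out D.s₀ w).1 then Sum.inl (State.first D.M₁.start)
        else Sum.inr false, T, (D.M₁.init (word₁ (transduce D.next D.out D.s₀ w).2)).tape,
        (D.M₂.init (word₂ (transduce D.next D.out D.s₀ w).2)).tape⟩ := by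
  obtain ⟨t, ht, h⟩ := exists_iterate_midConf D w.reverse []
  -- Read from the right: seeking the end, turning round, transducing, and the final step that
  -- starts `M₁` or rejects.
  refine ⟨1 + t + 1 + w.length, ?_, ?_⟩
  · rw [List.length_reverse] at ht
    nlinarith
  · refine ⟨(Tape.mk₂ [] (w.map some)).move Dir.left, ?_⟩
    rw [Function.iterate_add_apply, Tape.mk₁, iterate_seek, Function.iterate_add_apply,
      Function.iterate_add_apply, Function.iterate_one, confStep_seek_none, List.append_nil]
    have h0 : (⟨Sum.inl (State.emit D.s₀ ⟨[], Nat.zero_le _⟩),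
        (Tape.mk₂ (w.map some).reverse []).move Dir.left, fun _ => default,
        fun _ => default⟩ : D.Conf) = midConf D w.reverse [] := by
      simp [midConf, emitConf, transduce, shifted_nil]
    rw [h0, h, midConf, List.map_nil, confStep_emit_nil_none]
    simp

theorem confStep_first (d : D.M₁.Cfg) (q : D.M₁.Q) (hq : d.state = Sum.inl q) (T T₂) :
    D.confStep ⟨D.afterFirst d.state, T, d.tape, T₂⟩ =
      ⟨D.afterFirst (D.M₁.step d).state, T, (D.M₁.step d).tape, T₂⟩ := by
  simp [Data.confStep, Data.trans, Data.afterFirst, hq, step, act_head_none, Data.move]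

theorem confStep_second (d : D.M₂.Cfg) (q : D.M₂.Q) (hq : d.state = Sum.inl q) (T T₁) :
    D.confStep ⟨D.afterSecond d.state, T, T₁, d.tape⟩ =
      ⟨D.afterSecond (D.M₂.step d).state, T, T₁, (D.M₂.step d).tape⟩ := by
  simp [Data.confStep, Data.trans, Data.afterSecond, hq, step, act_head_none, Data.move]

/-- The simulation has no overhead: `afterFirst` translates the halting move of `M₁` itself, so the
handover takes no extra step. Fewer than `t` steps suffice if `M₁` has halted earlier. -/
theorem exists_iterate_first (t : ℕ) (d : D.M₁.Cfg) (b : Bool)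
    (h : (D.M₁.step^[t] d).state = Sum.inr b) (T T₂) :
    ∃ s ≤ t, ∃ T₁, D.confStep^[s] ⟨D.afterFirst d.state, T, d.tape, T₂⟩ =
      ⟨D.afterFirst (Sum.inr b), T, T₁, T₂⟩ := by
  induction t generalizing d with
  | zero => exact ⟨0, le_rfl, d.tape, by rw [← h]; rfl⟩
  | succ t ih =>
    obtain ⟨q, hq⟩ | ⟨b', hb⟩ : (∃ q, d.state = Sum.inl q) ∨ ∃ b, d.state = Sum.inr b := by
      cases h : d.state <;> simp
    · obtain ⟨s, hs, T₁, hT⟩ := ih (D.M₁.step d) h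
      exact ⟨s + 1, by omega, T₁, by
        rw [Function.iterate_succ_apply, confStep_first D d q hq, hT]⟩
    · rw [Function.iterate_fixed (step_eq_self_of_halt _ hb)] at h
      exact ⟨0, Nat.zero_le _, d.tape, by rw [← h]; rfl⟩

theorem exists_iterate_second (t : ℕ) (d : D.M₂.Cfg) (b : Bool)
    (h : (D.M₂.step^[t] d).state = Sum.inr b) (T T₁) :
    ∃ s ≤ t, ∃ T₂, D.confStep^[s] ⟨D.afterSecond d.state, T, T₁, d.tape⟩ =
      ⟨D.afterSecond (Sum.inr b), T, T₁, T₂⟩ := by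
  induction t generalizing d with
  | zero => exact ⟨0, le_rfl, d.tape, by rw [← h]; rfl⟩
  | succ t ih =>
    obtain ⟨q, hq⟩ | ⟨b', hb⟩ : (∃ q, d.state = Sum.inl q) ∨ ∃ b, d.state = Sum.inr b := by
      cases h : d.state <;> simp
    · obtain ⟨s, hs, T₁, hT⟩ := ih (D.M₂.step d) h
      exact ⟨s + 1, by omega, T₁, by
        rw [Function.iterate_succ_apply, confStep_second D d q hq, hT]⟩
    · rw [Function.iterate_fixed (step_eq_self_of_halt _ hb)] at h
      exact ⟨0, Nat.zero_le _, d.tape, by rw [← h]; rfl⟩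

variable [Finite α]

theorem state_run_of_iterate {w : List α} {t : ℕ} {b : Bool} {T T₁ T₂}
    (h : D.confStep^[t]
      ⟨Sum.inl State.seek, Tape.mk₁ (w.map some), fun _ => default, fun _ => default⟩ =
        ⟨Sum.inr b, T, T₁, T₂⟩) :
    (D.machine.run w t).state = Sum.inr b := by
  rw [← view_run] at h
  exact congrArg Data.Conf.state h

end Pipeline

open Pipeline in
/-- A machine that transduces its input into inputs of `M₁` and `M₂`, runs `M₁`, and runs `M₂` if
`M₁` says "yes". -/
theorem exists_machine_transduce {α : Type u} [Finite α] {β₁ β₂ : Type} {M₁ : MultiTapeTM β₁}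
    {M₂ : MultiTapeTM β₂} {L₁ : Language β₁} {L₂ : Language β₂} (h₁ : M₁.Decides L₁)
    (h₂ : M₂.Decides L₂) {S : Type} [Finite S] (s₀ : S) (next : α → S → S)
    (out₁ : α → S → List β₁) (out₂ : α → S → List β₂) (acc : S → Prop) :
    ∃ (N : MultiTapeTM α) (k : ℕ), N.Decides
        {w | acc (transduce next out₁ s₀ w).1 ∧ (transduce next out₁ s₀ w).2 ∈ L₁ ∧
          (transduce next out₂ s₀ w).2 ∈ L₂} ∧
      (∀ w, (transduce next out₁ s₀ w).2.length ≤ k * w.length) ∧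
      (∀ w, (transduce next out₂ s₀ w).2.length ≤ k * w.length) ∧
      (∀ w, N.time w ≤ (k * (w.length + 1) : ℕ) + M₁.time (transduce next out₁ s₀ w).2 +
        M₂.time (transduce next out₂ s₀ w).2) ∧
      ∀ w, ¬(acc (transduce next out₁ s₀ w).1 ∧ (transduce next out₁ s₀ w).2 ∈ L₁) →
        N.time w ≤ (k * (w.length + 1) : ℕ) + M₁.time (transduce next out₁ s₀ w).2 := by
  classical
  have := Fintype.ofFinite α
  have := Fintype.ofFinite S
  -- Tagging the letters merges both outputs into one; each is recovered by filtering on its tag.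
  let out : α → S → List (β₁ ⊕ β₂) := fun x s => (out₁ x s).map Sum.inl ++ (out₂ x s).map Sum.inr
  obtain ⟨k, hk⟩ : ∃ k, ∀ x s, (out x s).length ≤ k :=
    ⟨Finset.univ.sup fun p : α × S => (out p.1 p.2).length, fun x s =>
      Finset.le_sup (f := fun p : α × S => (out p.1 p.2).length) (Finset.mem_univ (x, s))⟩
  let D : Data α β₁ β₂ := ⟨M₁, M₂, S, inferInstance, s₀, next, k, out, hk, fun s => acc s⟩
  have e₁ : ∀ w, word₁ (transduce next out s₀ w).2 = (transduce next out₁ s₀ w).2 := by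
    intro w
    rw [word₁, filterMap_transduce]
    congr 2
    funext x s
    simp [out, List.filterMap_append, List.filterMap_map, Function.comp_def]
  have e₂ : ∀ w, word₂ (transduce next out s₀ w).2 = (transduce next out₂ s₀ w).2 := by
    intro w
    rw [word₂, filterMap_transduce]
    congr 2
    funext x s
    simp [out, List.filterMap_append, List.filterMap_map, Function.comp_def]
  have e₃ : ∀ w, (transduce next out s₀ w).1 = (transduce next out₁ s₀ w).1 :=
    transduce_fst_eq out out₁
  have key : ∀ w, ∃ (t : ℕ) (b : Bool), (D.machine.run w t).state = Sum.inr b ∧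
      (b = true ↔ acc (transduce next out₁ s₀ w).1 ∧ (transduce next out₁ s₀ w).2 ∈ L₁ ∧
          (transduce next out₂ s₀ w).2 ∈ L₂) ∧
      (t : ℕ∞) ≤ ((k + 2) * (w.length + 1) : ℕ) + M₁.time (transduce next out₁ s₀ w).2 +
        M₂.time (transduce next out₂ s₀ w).2 ∧
      (¬(acc (transduce next out₁ s₀ w).1 ∧ (transduce next out₁ s₀ w).2 ∈ L₁) →
        (t : ℕ∞) ≤ ((k + 2) * (w.length + 1) : ℕ) + M₁.time (transduce next out₁ s₀ w).2) := by
    intro w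
    obtain ⟨t₁, b₁, ht₁, hs₁, hb₁⟩ := h₁.exists_halt (transduce next out₁ s₀ w).2
    obtain ⟨t₂, b₂, ht₂, hs₂, hb₂⟩ := h₂.exists_halt (transduce next out₂ s₀ w).2
    obtain ⟨t, ht, T, h⟩ := exists_iterate_transduce D w
    simp only [D, e₁, e₂, e₃] at h
    rw [ht₁, ht₂]
    by_cases hacc : acc (transduce next out₁ s₀ w).1
    · simp only [hacc, decide_true, if_true] at h
      obtain ⟨s, hs, T₁, hT₁⟩ := exists_iterate_first D t₁ (M₁.init _) b₁ hs₁ T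
        (M₂.init (transduce next out₂ s₀ w).2).tape
      have h' := hT₁
      change D.confStep^[s] ⟨Sum.inl (State.first M₁.start), _, _, _⟩ = _ at h'
      rw [← h, ← Function.iterate_add_apply] at h'
      obtain _ | _ := b₁
      · refine ⟨_, false, state_run_of_iterate D h', ?_, ?_, fun _ => ?_⟩
        · simp only [Bool.false_eq_true, false_iff] at hb₁ ⊢
          tauto
        · norm_cast
          show s + t ≤ (k + 2) * (w.length + 1) + t₁ + t₂
          have : t ≤ (k + 2) * (w.length + 1) := ht
          omega
        · norm_cast
          show s + t ≤ (k + 2) * (w.length + 1) + t₁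
          have : t ≤ (k + 2) * (w.length + 1) := ht
          omega
      · obtain ⟨r, hr, T₂, hT₂⟩ := exists_iterate_second D t₂ (M₂.init _) b₂ hs₂ T T₁
        change D.confStep^[r] (⟨D.afterFirst (Sum.inr true), _, _, _⟩ : D.Conf) = _ at hT₂
        rw [← h', ← Function.iterate_add_apply] at hT₂
        refine ⟨_, b₂, state_run_of_iterate D hT₂, ?_, ?_, fun hn => ?_⟩
        · simp only [true_iff] at hb₁
          tauto
        · norm_cast
          show r + (s + t) ≤ (k + 2) * (w.length + 1) + t₁ + t₂
          have : t ≤ (k + 2) * (w.length + 1) := ht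
          omega
        · exact absurd ⟨hacc, hb₁.1 rfl⟩ hn
    · simp only [hacc, decide_false] at h
      refine ⟨t, false, state_run_of_iterate D h, by simp [hacc], ?_, fun _ => ?_⟩
      · norm_cast
        show t ≤ (k + 2) * (w.length + 1) + t₁ + t₂
        have : t ≤ (k + 2) * (w.length + 1) := ht
        omega
      · norm_cast
        show t ≤ (k + 2) * (w.length + 1) + t₁
        have : t ≤ (k + 2) * (w.length + 1) := ht
        omega
  refine ⟨D.machine, k + 2, fun w => ?_, fun w => ?_, fun w => ?_, fun w => ?_, fun w hw => ?_⟩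
  · obtain ⟨t, b, h, hb, -⟩ := key w
    exact ⟨t, b, h, hb⟩
  · refine (length_transduce_le (k := k) (fun x s => ?_) w).trans (by gcongr; omega)
    have := hk x s
    simp only [out, List.length_append, List.length_map] at this
    omega
  · refine (length_transduce_le (k := k) (fun x s => ?_) w).trans (by gcongr; omega)
    have := hk x s
    simp only [out, List.length_append, List.length_map] at this
    omega
  · obtain ⟨t, b, h, -, ht, -⟩ := key w
    exact (D.machine.time_le_of_halt h).trans ht
  · obtain ⟨t, b, h, -, -, ht⟩ := key w
    exact (D.machine.time_le_of_halt h).trans (ht hw)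

/-! ### Words -/

section Words

variable {A G : Type*} [Group G] (π : A → G)

@[simp]
theorem wordVal_nil : wordVal π [] = 1 := rfl

@[simp]
theorem wordVal_cons (x : A × Bool) (w : List (A × Bool)) :
    wordVal π (x :: w) = letterVal π x * wordVal π w := by
  simp [wordVal]

@[simp]
theorem wordVal_append (v w : List (A × Bool)) :
    wordVal π (v ++ w) = wordVal π v * wordVal π w := by
  simp [wordVal]

theorem letterVal_not (x : A × Bool) : letterVal π (x.1, !x.2) = (letterVal π x)⁻¹ := by
  obtain ⟨a, _ | _⟩ := x <;> simp [letterVal]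

theorem exists_wordVal_inv (w : List (A × Bool)) : ∃ v, wordVal π v = (wordVal π w)⁻¹ := by
  induction w with
  | nil => exact ⟨[], by simp⟩
  | cons x w ih =>
    obtain ⟨v, hv⟩ := ih
    exact ⟨v ++ [(x.1, !x.2)], by simp [hv, letterVal_not]⟩

theorem Generates.exists_wordVal_eq {π : A → G} (hπ : Generates π) (g : G) :
    ∃ w, wordVal π w = g := by
  have hg : g ∈ Subgroup.closure (Set.range π) := by rw [hπ]; trivial
  induction hg using Subgroup.closure_induction with
  | mem x hx =>
    obtain ⟨a, rfl⟩ := hx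
    exact ⟨[(a, true)], by simp [letterVal]⟩
  | one => exact ⟨[], rfl⟩
  | mul x y _ _ hx hy =>
    obtain ⟨v, rfl⟩ := hx
    obtain ⟨w, rfl⟩ := hy
    exact ⟨v ++ w, by simp⟩
  | inv x _ hx =>
    obtain ⟨v, rfl⟩ := hx
    exact exists_wordVal_inv π v

end Words

/-! ### Expansion of group actions -/

section Expansion

open Classical in
/-- The number of points of `F` that `g` moves out of `F`. -/
noncomputable def leaving {G V : Type*} [Group G] [MulAction G V] (g : G) (F : Finset V) : ℕ :=
  (F.filter fun v => g • v ∉ F).card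

/-- The family `s` of elements of `G` moves many points of each finite subset of `V` out of it. -/
def Expands {G : Type*} (V : Type*) [Group G] [MulAction G V] {X : Type*} [Fintype X] (s : X → G)
    (ε : ℝ) : Prop :=
  ∀ F : Finset V, ε * (F.card : ℝ) ≤ ((∑ x, leaving (s x) F : ℕ) : ℝ)

variable {G : Type*} [Group G]

theorem leaving_one {V : Type*} [MulAction G V] (F : Finset V) : leaving (1 : G) F = 0 := by
  simp [leaving, Finset.filter_eq_empty_iff]

/-- If `g * h` moves `v` out of `F`, either `h` already does, or `h • v` is a point of `F` that `g`
moves out. -/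
theorem leaving_mul_le {V : Type*} [MulAction G V] (g h : G) (F : Finset V) :
    leaving (g * h) F ≤ leaving g F + leaving h F := by
  classical
  have hsub : (F.filter fun v => (g * h) • v ∉ F) ⊆
      (Finset.image (fun v => h⁻¹ • v) (F.filter fun v => g • v ∉ F) : Finset V) ∪
        (F.filter fun v => h • v ∉ F) := by
    intro v hv
    simp only [Finset.mem_filter, Finset.mem_union, Finset.mem_image] at hv ⊢
    by_cases hh : h • v ∈ F
    · exact Or.inl ⟨h • v, ⟨hh, by simpa [mul_smul] using hv.2⟩, by simp⟩
    · exact Or.inr ⟨hv.1, hh⟩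
  refine (Finset.card_le_card hsub).trans ((Finset.card_union_le _ _).trans ?_)
  unfold leaving
  exact Nat.add_le_add_right Finset.card_image_le _

theorem leaving_wordVal_le {V : Type*} [MulAction G V] {A : Type*} [Fintype A] (π : A → G)
    (w : List (A × Bool)) (F : Finset V) :
    leaving (wordVal π w) F ≤ w.length * ∑ x, leaving (letterVal π x) F := by
  induction w with
  | nil => simp [leaving_one]
  | cons x w ih =>
    rw [wordVal_cons, List.length_cons, add_mul, one_mul, add_comm]
    refine (leaving_mul_le _ _ _).trans (add_le_add ?_ ih)
    exact Finset.single_le_sum (f := fun x => leaving (letterVal π x) F) (fun _ _ => Nat.zero_le _)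
      (Finset.mem_univ x)

/-- Expansion with respect to some finite family implies expansion with respect to every finite
generating set. -/
theorem Expands.of_generates {V : Type*} [MulAction G V] {Y A : Type*} [Fintype Y] [Fintype A]
    {s : Y → G} {ε : ℝ} (hε : 0 < ε) (h : Expands V s ε) {π : A → G} (hπ : Generates π) :
    ∃ δ : ℝ, 0 < δ ∧ Expands V (letterVal π) δ := by
  choose w hw using fun y => hπ.exists_wordVal_eq (s y)
  set m := ∑ y, (w y).length with hm
  -- Each `s y` is a word whose letters together account for its exits from `F`; the `+ 1` keeps the
  -- denominator positive when all these words are empty.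
  refine ⟨ε / (m + 1), by positivity, fun F => ?_⟩
  rw [div_mul_eq_mul_div, div_le_iff₀ (by positivity)]
  refine (h F).trans ?_
  have : ∑ y, leaving (s y) F ≤ (∑ x, leaving (letterVal π x) F) * (m + 1) := by
    calc ∑ y, leaving (s y) F ≤ ∑ y, (w y).length * ∑ x, leaving (letterVal π x) F :=
          Finset.sum_le_sum fun y _ => by
            rw [← hw y]; exact leaving_wordVal_le π (w y) F
      _ = m * ∑ x, leaving (letterVal π x) F := by rw [hm, Finset.sum_mul]
      _ ≤ _ := by rw [mul_comm]; gcongr; omega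
  exact_mod_cast this

/-- Inversion turns right cosets into left cosets, and right translation by `x` into the left action
of `x⁻¹`. Since the alphabet is symmetric, boundary edges inject into the pairs counted by
`leaving`, with inverted labels. -/
theorem SchreierNonamenable.exists_expands {A : Type*} [Fintype A] {π : A → G} {K : Subgroup G}
    (h : SchreierNonamenable π K) : ∃ ε : ℝ, 0 < ε ∧ Expands (G ⧸ K) (letterVal π) ε := by
  classical
  obtain ⟨ε, hε, h⟩ := h
  refine ⟨ε, hε, fun F => ?_⟩
  obtain rfl | hF := F.eq_empty_or_nonempty
  · simp only [Finset.card_empty, Nat.cast_zero, mul_zero]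
    positivity
  let e : RightCosets K ≃ G ⧸ K := QuotientGroup.quotientRightRelEquivQuotientLeftRel K
  have he : ∀ (x : G) (v : RightCosets K), e (RightCosets.translate K x v) = x⁻¹ • e v := by
    intro x v
    induction v using Quotient.inductionOn with
    | h g =>
      change (((g * x)⁻¹ : G) : G ⧸ K) = x⁻¹ • ((g⁻¹ : G) : G ⧸ K)
      rw [mul_inv_rev]
      rfl
  let F' : Set (RightCosets K) := e ⁻¹' F
  have hF' : F'.Finite := F.finite_toSet.preimage e.injective.injOn
  have hcard : F'.ncard = F.card := by
    rw [← Set.ncard_coe_finset F]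
    exact Set.ncard_preimage_of_injective_subset_range e.injective (by simp)
  have := h F' hF' (by
    obtain ⟨v, hv⟩ := hF
    exact ⟨e.symm v, by simpa [F'] using hv⟩)
  rw [hcard] at this
  refine this.trans ?_
  norm_cast
  let B : Finset (Sigma fun _ : A × Bool => G ⧸ K) :=
    Finset.univ.sigma fun x => F.filter fun v => letterVal π x • v ∉ F
  have hB : B.card = ∑ x, leaving (letterVal π x) F := by
    rw [Finset.card_sigma]
    refine Finset.sum_congr rfl fun x _ => ?_
    unfold leaving
    congr
  rw [← hB, ← Set.ncard_coe_finset B]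
  refine Set.ncard_le_ncard_of_injOn (fun d => ⟨(d.2.1, !d.2.2), e d.1⟩) ?_ ?_ B.finite_toSet
  · rintro ⟨v, x⟩ ⟨h1, h2⟩
    simp only [B, Finset.coe_sigma, Set.mem_sigma_iff, Finset.coe_univ, Set.mem_univ, true_and,
      Finset.coe_filter, Set.mem_ofPred_eq, letterVal_not]
    refine ⟨h1, ?_⟩
    rw [← he]
    exact h2
  · rintro ⟨v, x, b⟩ - ⟨v', x', b'⟩ - h
    simpa [and_comm, and_assoc] using h

/-- Expansion of `Gbar ⧸ K` pulls back along an epimorphism from a subgroup of finite index. -/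
theorem Expands.of_finiteIndex {Gbar : Type*} [Group Gbar] {G₁ : Subgroup G} [Fintype (G ⧸ G₁)]
    {φ : G₁ →* Gbar} (hφ : Function.Surjective φ) {K : Subgroup Gbar} {X : Type*} [Fintype X]
    {s : X → Gbar} {ε : ℝ} (h : Expands (Gbar ⧸ K) s ε) :
    ∃ s' : (G ⧸ G₁) × X → G, Expands (G ⧸ (K.comap φ).map G₁.subtype) s' ε := by
  classical
  set P : Subgroup G := (K.comap φ).map G₁.subtype with hP
  have ht : ∀ g : G, ((g : G ⧸ G₁).out)⁻¹ * g ∈ G₁ := fun g =>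
    QuotientGroup.eq.1 (QuotientGroup.out_eq' (g : G ⧸ G₁))
  -- The map `gP ↦ (gG₁, r(g)K)` embeds `G ⧸ P` in `(G ⧸ G₁) × (Gbar ⧸ K)`; `key` shows that the
  -- chosen representatives do not matter.
  let r : G → Gbar := fun g => φ ⟨_, ht g⟩
  let c : G ⧸ P → G ⧸ G₁ := fun v => (v.out : G)
  let ψ : G ⧸ P → Gbar ⧸ K := fun v => (r v.out : Gbar)
  have key : ∀ g : G, c (g : G ⧸ P) = (g : G ⧸ G₁) ∧ ψ (g : G ⧸ P) = (r g : Gbar ⧸ K) := by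
    intro g
    have hg := QuotientGroup.eq.1 (QuotientGroup.out_eq' (g : G ⧸ P)).symm
    obtain ⟨p, hp, hpg⟩ := hg
    have hp' : (g : G ⧸ P).out = g * p := by
      have : (p : G) = g⁻¹ * (g : G ⧸ P).out := hpg
      rw [this, mul_inv_cancel_left]
    have hc : (((g : G ⧸ P).out : G) : G ⧸ G₁) = (g : G ⧸ G₁) := by
      rw [hp']
      exact (QuotientGroup.eq.2 (by simp)).symm
    refine ⟨hc, QuotientGroup.eq.2 ?_⟩
    have hr : r (g : G ⧸ P).out = r g * φ p := by
      simp only [r, ← map_mul]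
      congr 1
      ext
      simp only [hc, Subgroup.coe_mul, mul_assoc]
      rw [hp']
    rw [hr]
    simpa using K.inv_mem hp
  have hinj : ∀ v v', c v = c v' → ψ v = ψ v' → v = v' := by
    intro v v' hc hψ
    rw [← QuotientGroup.out_eq' v, ← QuotientGroup.out_eq' v']
    refine QuotientGroup.eq.2 ⟨⟨_, ht v.out⟩⁻¹ * ⟨_, ht v'.out⟩, ?_, ?_⟩
    · have := QuotientGroup.eq.1 hψ
      simpa [r] using this
    · change (v.out : G ⧸ G₁) = (v'.out : G ⧸ G₁) at hc
      simp [hc]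
  choose lift hlift using fun x => hφ (s x)
  -- Conjugating a lift of `s x` by the representative of a coset `a` gives an element that
  -- preserves the fibre over `a` and acts there as `s x`. Expansion can then be applied fibre by
  -- fibre.
  let s' : (G ⧸ G₁) × X → G := fun p => p.1.out * lift p.2 * p.1.out⁻¹
  have hs' : ∀ (v : G ⧸ P) (x : X),
      c (s' (c v, x) • v) = c v ∧ ψ (s' (c v, x) • v) = s x • ψ v := by
    intro v x
    have hv : s' (c v, x) • v = ((s' (c v, x) * v.out : G) : G ⧸ P) := 
      (congrArg (s' (c v, x) • ·) (QuotientGroup.out_eq' v)).symm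
    have hc : ((s' (c v, x) * v.out : G) : G ⧸ G₁) = c v := by
      rw [← QuotientGroup.out_eq' (c v)]
      refine QuotientGroup.eq.2 ?_
      have := G₁.inv_mem (G₁.mul_mem (lift x).2 (ht v.out))
      simpa [s', c, mul_assoc] using this
    rw [hv]
    refine ⟨(key _).1.trans hc, (key _).2.trans ?_⟩
    change ((r _ : Gbar) : Gbar ⧸ K) = ((s x * r v.out : Gbar) : Gbar ⧸ K)
    rw [← hlift]
    simp only [r, ← map_mul]
    congr 2
    ext
    simp only [hc, Subgroup.coe_mul]
    simp [s', c, mul_assoc]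
  refine ⟨s', fun F => ?_⟩
  have hle : ∀ a x, leaving (s x) ((F.filter fun v => c v = a).image ψ) ≤ leaving (s' (a, x)) F := by
    intro a x
    unfold leaving
    refine le_trans (Finset.card_le_card ?_) (Finset.card_image_le (f := ψ))
    intro y hy
    simp only [Finset.mem_filter, Finset.mem_image] at hy ⊢
    obtain ⟨⟨v, ⟨hvF, rfl⟩, rfl⟩, hy⟩ := hy
    exact ⟨v, ⟨hvF, fun hF => hy ⟨_, ⟨hF, (hs' v x).1⟩, (hs' v x).2⟩⟩, rfl⟩
  have hF : F.card = ∑ a, ((F.filter fun v => c v = a).image ψ).card := by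
    rw [Finset.card_eq_sum_card_fiberwise (f := c) (t := Finset.univ) (by simp)]
    refine Finset.sum_congr rfl fun a _ => (Finset.card_image_of_injOn ?_).symm
    intro v hv v' hv' hvv
    simp only [Finset.coe_filter, Set.mem_ofPred_eq] at hv hv'
    exact hinj v v' (hv.2.trans hv'.2.symm) hvv
  rw [hF, Fintype.sum_prod_type]
  push_cast
  rw [Finset.mul_sum]
  refine Finset.sum_le_sum fun a _ => (h _).trans ?_
  push_cast
  exact Finset.sum_le_sum fun x _ => by exact_mod_cast hle a x

end Expansion

/-! ### Expansion and norms of averaging operators -/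

section Spectral

variable {G : Type*} [Group G] {V : Type*} [MulAction G V] {X : Type*} [Fintype X] {s : X → G}
  {ε : ℝ}

/-- The co-area inequality. -/
theorem Expands.mul_sum_le (hs : Expands V s ε) {W : Finset V} {h : V → ℕ}
    (hW : ∀ v ∉ W, h v = 0) :
    ε * ∑ v ∈ W, (h v : ℝ) ≤ ∑ x, ∑ v ∈ W, ((h v - h (s x • v) : ℕ) : ℝ) := by
  classical
  set N := W.sup h
  have hN : ∀ v ∈ W, h v ≤ N := fun v hv => Finset.le_sup hv
  -- Slice `h` into its superlevel sets. The truncated difference at `v` counts the levels `k` for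
  -- which `s x` moves `v` out of the set where `h` exceeds `k`; expansion is applied to each level.
  have h1 : ∑ v ∈ W, h v = ∑ k ∈ Finset.range N, (W.filter fun v => k < h v).card := by
    simp only [Finset.card_filter]
    rw [Finset.sum_comm]
    refine Finset.sum_congr rfl fun v hv => ?_
    rw [← Finset.card_filter]
    have : (Finset.range N).filter (fun k => k < h v) = Finset.range (h v) := by
      ext k
      have := hN v hv
      simp only [Finset.mem_filter, Finset.mem_range]
      omega
    rw [this, Finset.card_range]
  have h2 : ∀ x, ∑ v ∈ W, (h v - h (s x • v)) =
      ∑ k ∈ Finset.range N, leaving (s x) (W.filter fun v => k < h v) := by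
    intro x
    have : ∀ k, leaving (s x) (W.filter fun v => k < h v) =
        ∑ v ∈ W, if k < h v ∧ h (s x • v) ≤ k then 1 else 0 := by
      intro k
      rw [← Finset.card_filter, leaving, Finset.filter_filter]
      congr 1
      refine Finset.filter_congr fun v hv => ?_
      simp only [Finset.mem_filter, not_and, not_lt]
      refine and_congr_right fun _ => ⟨fun H => ?_, fun H _ => H⟩
      by_cases hm : s x • v ∈ W
      · exact H hm
      · simp [hW _ hm]
    simp only [this]
    rw [Finset.sum_comm]
    refine Finset.sum_congr rfl fun v hv => ?_
    rw [← Finset.card_filter]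
    have : (Finset.range N).filter (fun k => k < h v ∧ h (s x • v) ≤ k) =
        Finset.Ico (h (s x • v)) (h v) := by
      ext k
      have := hN v hv
      simp only [Finset.mem_filter, Finset.mem_range, Finset.mem_Ico]
      omega
    rw [this, Nat.card_Ico]
  have e1 : ∑ v ∈ W, (h v : ℝ) =
      ∑ k ∈ Finset.range N, (((W.filter fun v => k < h v).card : ℕ) : ℝ) := by
    exact_mod_cast h1
  have e2 : ∑ x, ∑ v ∈ W, ((h v - h (s x • v) : ℕ) : ℝ) =
      ∑ k ∈ Finset.range N, ((∑ x, leaving (s x) (W.filter fun v => k < h v) : ℕ) : ℝ) := by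
    have : ∑ x, ∑ v ∈ W, (h v - h (s x • v)) =
        ∑ k ∈ Finset.range N, ∑ x, leaving (s x) (W.filter fun v => k < h v) := by
      rw [Finset.sum_comm (s := Finset.range N)]
      exact Finset.sum_congr rfl fun x _ => h2 x
    exact_mod_cast this
  rw [e1, e2, Finset.mul_sum]
  exact Finset.sum_le_sum fun k _ => hs _

/-- Translation is injective, so the left side sums `f` over a translate of `W`, and `f` vanishes
outside `W`. -/
theorem sum_smul_le (g : G) {W : Finset V} {f : V → ℝ} (hf : ∀ v, 0 ≤ f v)
    (hW : ∀ v ∉ W, f v = 0) : ∑ v ∈ W, f (g • v) ≤ ∑ v ∈ W, f v := by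
  classical
  calc ∑ v ∈ W, f (g • v) = ∑ v ∈ W.image (g • ·), f v :=
        (Finset.sum_image (MulAction.injective g).injOn).symm
    _ ≤ ∑ v ∈ W.image (g • ·) ∪ W, f v :=
        Finset.sum_le_sum_of_subset_of_nonneg Finset.subset_union_left fun v _ _ => hf v
    _ = ∑ v ∈ W, f v :=
        (Finset.sum_subset Finset.subset_union_right fun v _ hv => hW v hv).symm

/-- The adjoint of translation by `g` is translation by `g⁻¹`: substitute in the sum over all of
`V`, where `W` plays no role. -/
theorem sum_mul_smul_comm (g : G) {W : Finset V} {f h : V → ℝ} (hf : ∀ v ∉ W, f v = 0)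
    (hh : ∀ v ∉ W, h v = 0) :
    ∑ v ∈ W, f v * h (g • v) = ∑ v ∈ W, h v * f (g⁻¹ • v) := by
  rw [← tsum_eq_sum (L := .unconditional V) (f := fun v => f v * h (g • v)) fun v hv => by rw [hf v hv, zero_mul],
    ← tsum_eq_sum (L := .unconditional V) (f := fun v => h v * f (g⁻¹ • v)) fun v hv => by rw [hh v hv, zero_mul],
    ← (MulAction.toPerm g).tsum_eq (fun v => h v * f (g⁻¹ • v))]
  simp [mul_comm]

/-- Cheeger's inequality. -/
theorem Expands.sum_mul_smul_le (hs : Expands V s ε) (hε : 0 ≤ ε) (hX : 0 < Fintype.card X)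
    {W : Finset V} {f : V → ℕ} (hW : ∀ v ∉ W, f v = 0) :
    ∑ x, ∑ v ∈ W, (f v : ℝ) * f (s x • v) ≤
      (1 - ε ^ 2 / (8 * (Fintype.card X : ℝ) ^ 2)) * Fintype.card X * ∑ v ∈ W, (f v : ℝ) ^ 2 := by
  set d : ℝ := (Fintype.card X : ℝ) with hd
  have hd0 : 0 < d := Nat.cast_pos.2 hX
  set Q := ∑ v ∈ W, (f v : ℝ) ^ 2 with hQ
  set R := ∑ x, ∑ v ∈ W, (f v : ℝ) * f (s x • v) with hR
  have hQ0 : 0 ≤ Q := Finset.sum_nonneg fun v _ => by positivity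
  have htrans : ∑ x, ∑ v ∈ W, (f (s x • v) : ℝ) ^ 2 ≤ d * Q := by
    calc ∑ x, ∑ v ∈ W, (f (s x • v) : ℝ) ^ 2 ≤ ∑ _x : X, Q :=
          Finset.sum_le_sum fun x _ => sum_smul_le (f := fun v => (f v : ℝ) ^ 2) (s x)
            (fun v => by positivity) (fun v hv => by simp [hW v hv])
      _ = d * Q := by simp [hd]
  have hconst : ∑ _x : X, Q = d * Q := by simp [hd]
  have hS : ∑ x, ∑ v ∈ W, |(f v : ℝ) - f (s x • v)| ^ 2 ≤ 2 * (d * Q) - 2 * R := by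
    have : ∑ x, ∑ v ∈ W, |(f v : ℝ) - f (s x • v)| ^ 2 =
        ∑ _x : X, Q + ∑ x, ∑ v ∈ W, (f (s x • v) : ℝ) ^ 2 - 2 * R := by
      rw [hQ, hR, Finset.mul_sum, ← Finset.sum_add_distrib, ← Finset.sum_sub_distrib]
      refine Finset.sum_congr rfl fun x _ => ?_
      rw [Finset.mul_sum, ← Finset.sum_add_distrib, ← Finset.sum_sub_distrib]
      refine Finset.sum_congr rfl fun v _ => ?_
      rw [sq_abs]
      ring
    rw [this, hconst]
    linarith
  have hT : ∑ x, ∑ v ∈ W, ((f v : ℝ) + f (s x • v)) ^ 2 ≤ 4 * (d * Q) := by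
    have : ∑ x, ∑ v ∈ W, ((f v : ℝ) + f (s x • v)) ^ 2 ≤
        2 * (∑ _x : X, Q + ∑ x, ∑ v ∈ W, (f (s x • v) : ℝ) ^ 2) := by
      rw [hQ, ← Finset.sum_add_distrib, Finset.mul_sum]
      refine Finset.sum_le_sum fun x _ => ?_
      rw [← Finset.sum_add_distrib, Finset.mul_sum]
      refine Finset.sum_le_sum fun v _ => ?_
      nlinarith [sq_nonneg ((f v : ℝ) - f (s x • v))]
    rw [hconst] at this
    linarith
  -- The co-area inequality for `f ^ 2`, with the difference of squares factored so that
  -- Cauchy–Schwarz separates the energy of `f` from a term of order `d * Q`.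
  have hco : ε * Q ≤ ∑ x, ∑ v ∈ W, |(f v : ℝ) - f (s x • v)| * ((f v : ℝ) + f (s x • v)) := by
    have := hs.mul_sum_le (h := fun v => f v ^ 2) (W := W) (fun v hv => by simp [hW v hv])
    push_cast at this
    refine this.trans (Finset.sum_le_sum fun x _ => Finset.sum_le_sum fun v _ => ?_)
    obtain h | h := le_total (f (s x • v)) (f v)
    · rw [Nat.cast_sub (Nat.pow_le_pow_left h 2), abs_of_nonneg (by
        rw [sub_nonneg]; exact_mod_cast h)]
      push_cast
      exact le_of_eq (by ring)
    · rw [Nat.sub_eq_zero_of_le (Nat.pow_le_pow_left h 2), Nat.cast_zero]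
      positivity
  have hCS : (∑ x, ∑ v ∈ W, |(f v : ℝ) - f (s x • v)| * ((f v : ℝ) + f (s x • v))) ^ 2 ≤
      (∑ x, ∑ v ∈ W, |(f v : ℝ) - f (s x • v)| ^ 2) *
        ∑ x, ∑ v ∈ W, ((f v : ℝ) + f (s x • v)) ^ 2 := by
    simp only [← Finset.sum_product']
    exact Finset.sum_mul_sq_le_sq_mul_sq _ _ _
  have hmain : ε ^ 2 * Q ^ 2 ≤ (2 * (d * Q) - 2 * R) * (4 * (d * Q)) := by
    calc ε ^ 2 * Q ^ 2 = (ε * Q) ^ 2 := by ring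
      _ ≤ _ := pow_le_pow_left₀ (by positivity) hco 2
      _ ≤ _ := hCS
      _ ≤ _ := mul_le_mul hS hT
        (Finset.sum_nonneg fun x _ => Finset.sum_nonneg fun v _ => by positivity)
        (le_trans (Finset.sum_nonneg fun x _ => Finset.sum_nonneg fun v _ => by positivity) hS)
  -- One factor `Q` has to be cancelled from `hmain`.
  obtain hQ1 | hQ1 := hQ0.eq_or_lt
  · have hf : ∀ v ∈ W, (f v : ℝ) = 0 := by
      have := (Finset.sum_eq_zero_iff_of_nonneg (s := W) (f := fun v => (f v : ℝ) ^ 2)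
        (fun v _ => by positivity)).1 hQ1.symm
      intro v hv
      simpa using this v hv
    have : R = 0 := Finset.sum_eq_zero fun x _ => Finset.sum_eq_zero fun v hv => by
      rw [hf v hv, zero_mul]
    rw [this, ← hQ1, mul_zero]
  · have h3 : ε ^ 2 * Q ≤ 8 * d * (d * Q - R) := by
      refine le_of_mul_le_mul_right ?_ hQ1
      linarith [hmain]
    have h4 : (1 - ε ^ 2 / (8 * d ^ 2)) * d * Q = d * Q - ε ^ 2 * Q / (8 * d) := by
      field_simp
    rw [h4, le_sub_iff_add_le, ← le_sub_iff_add_le', div_le_iff₀ (by positivity)]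
    linarith

/-- The averaging operator of a symmetric expanding family is a contraction of `ℓ²`. -/
theorem Expands.exists_sum_sq_le (hs : Expands V s ε) (hε : 0 < ε) (hX : 0 < Fintype.card X)
    (σ : X ≃ X) (hσ : ∀ x, s (σ x) = (s x)⁻¹) :
    ∃ κ : ℝ, 0 < κ ∧ κ < 1 ∧ ∀ (W : Finset V) (f : V → ℕ), (∀ v ∉ W, f v = 0) →
      (∀ v ∉ W, ∑ x, f (s x • v) = 0) →
      ∑ v ∈ W, ((∑ x, f (s x • v) : ℕ) : ℝ) ^ 2 ≤
        κ * (Fintype.card X : ℝ) ^ 2 * ∑ v ∈ W, (f v : ℝ) ^ 2 := by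
  set d : ℝ := (Fintype.card X : ℝ) with hd
  have hd0 : 0 < d := Nat.cast_pos.2 hX
  -- Cheeger bounds the quadratic form only from above and only on nonnegative functions. The
  -- maximum with `1 / 2` makes the constant positive.
  set ρ : ℝ := max (1 / 2) (1 - ε ^ 2 / (8 * d ^ 2)) with hρ
  have hρ1 : ρ < 1 := by
    rw [hρ, max_lt_iff]
    refine ⟨by norm_num, ?_⟩
    rw [sub_lt_self_iff]
    positivity
  have hρ0 : 0 < ρ := lt_of_lt_of_le (by norm_num) (le_max_left _ _)
  refine ⟨ρ / (2 - ρ), div_pos hρ0 (by linarith), by rw [div_lt_one (by linarith)]; linarith, ?_⟩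
  intro W f hf hAf
  set a : V → ℕ := fun v => ∑ x, f (s x • v) with ha
  let B : (V → ℝ) → (V → ℝ) → ℝ := fun p q => ∑ x, ∑ v ∈ W, p v * q (s x • v)
  have hB : ∀ g : V → ℕ, (∀ v ∉ W, g v = 0) →
      B (fun v => g v) (fun v => g v) ≤ ρ * d * ∑ v ∈ W, (g v : ℝ) ^ 2 := by
    intro g hg
    refine (hs.sum_mul_smul_le hε.le hX hg).trans ?_
    gcongr
    exact le_max_right _ _
  set U := ∑ v ∈ W, (f v : ℝ) ^ 2 with hU
  set Q := ∑ v ∈ W, (a v : ℝ) ^ 2 with hQ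
  have haf : B (fun v => a v) (fun v => f v) = Q := by
    simp only [B, hQ]
    rw [Finset.sum_comm]
    refine Finset.sum_congr rfl fun v _ => ?_
    rw [← Finset.mul_sum, sq]
    simp [ha]
  -- Symmetry of the family makes the adjacency operator self-adjoint.
  have hfa : B (fun v => f v) (fun v => a v) = Q := by
    rw [← haf]
    simp only [B]
    rw [← σ.sum_comp]
    refine Finset.sum_congr rfl fun x _ => ?_
    rw [sum_mul_smul_comm (f := fun v => (f v : ℝ)) (h := fun v => (a v : ℝ)) _
      (fun v hv => by simp [hf v hv]) (fun v hv => by exact_mod_cast hAf v hv), hσ, inv_inv]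
  have hp : B (fun v => d * f v + a v) (fun v => d * f v + a v) ≤
      ρ * d * ∑ v ∈ W, (d * f v + a v) ^ 2 := by
    have := hB (fun v => Fintype.card X * f v + a v) fun v hv => by
      simp only [hf v hv, mul_zero, zero_add]
      exact hAf v hv
    push_cast at this
    exact this
  -- The bound from below comes from the absolute value of `d * f - a`: it has the same norm, is
  -- natural-valued, and its form dominates the negated one.
  have hm : -B (fun v => d * f v - a v) (fun v => d * f v - a v) ≤
      ρ * d * ∑ v ∈ W, (d * f v - a v) ^ 2 := by
    have := hB (fun v => (Fintype.card X * f v - a v : ℤ).natAbs) fun v hv => by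
      have : a v = 0 := hAf v hv
      simp [hf v hv, this]
    simp only [Nat.cast_natAbs, Int.cast_abs, sq_abs] at this
    push_cast at this
    refine le_trans ?_ this
    simp only [B, ← Finset.sum_neg_distrib]
    refine Finset.sum_le_sum fun x _ => Finset.sum_le_sum fun v _ => ?_
    rw [← abs_mul]
    exact neg_le_abs _
  -- Polarization expresses the squared norm `Q` of `a` by the two forms just bounded; the
  -- parallelogram law `hse` then gives `(2 - ρ) * Q ≤ ρ * d ^ 2 * U`.
  have hpe : B (fun v => d * f v + a v) (fun v => d * f v + a v) -
      B (fun v => d * f v - a v) (fun v => d * f v - a v) = 2 * d * (Q + Q) := by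
    nth_rewrite 1 [← haf]
    rw [← hfa]
    simp only [B, ← Finset.sum_sub_distrib, ← Finset.sum_add_distrib, Finset.mul_sum]
    refine Finset.sum_congr rfl fun x _ => Finset.sum_congr rfl fun v _ => ?_
    ring
  have hse : ∑ v ∈ W, (d * f v + a v) ^ 2 + ∑ v ∈ W, (d * f v - a v) ^ 2 =
      2 * (d ^ 2 * U + Q) := by
    rw [hU, hQ]
    simp only [Finset.mul_sum, ← Finset.sum_add_distrib]
    refine Finset.sum_congr rfl fun v _ => ?_
    ring
  have h1 : 2 * d * (Q + Q) ≤ ρ * d * (2 * (d ^ 2 * U + Q)) := by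
    rw [← hpe, ← hse, mul_add]
    linarith
  have h2 : (2 - ρ) * Q ≤ ρ * d ^ 2 * U := by
    refine le_of_mul_le_mul_left ?_ (mul_pos two_pos hd0)
    linarith
  rw [div_mul_eq_mul_div, div_mul_eq_mul_div, le_div_iff₀ (by linarith)]
  linarith

end Spectral

/-! ### The number of words that represent elements of a subgroup -/

section Counting

/-- The exchange of the letters `a` and `a⁻¹`. -/
def letterInv (A : Type*) : A × Bool ≃ A × Bool :=
  (Equiv.refl A).prodCongr Equiv.boolNot

theorem letterVal_letterInv {G : Type*} [Group G] {A : Type*} (π : A → G) (x : A × Bool) :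
    letterVal π (letterInv A x) = (letterVal π x)⁻¹ :=
  letterVal_not π x

variable {G : Type*} [Group G] {A : Type*} [Fintype A]

open Classical in
/-- The number of words of length `n` that move the point `o` to `v`. -/
noncomputable def wordCount {V : Type*} [MulAction G V] (π : A → G) (o : V) (n : ℕ) (v : V) : ℕ :=
  ∑ f : Fin n → A × Bool, if wordVal π (List.ofFn f) • o = v then 1 else 0

variable {V : Type*} [MulAction G V] (π : A → G) (o : V)

/-- Splitting off the first letter: `x * u` moves `o` to `v` exactly if `u` moves `o` to `x⁻¹ • v`.
Thus word counts are iterates of the adjacency operator applied to a point mass. -/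
theorem wordCount_succ (n : ℕ) (v : V) :
    wordCount π o (n + 1) v = ∑ x, wordCount π o n (letterVal π x • v) := by
  classical
  rw [← (letterInv A).sum_comp]
  unfold wordCount
  rw [← (Fin.consEquiv fun _ => A × Bool).sum_comp, Fintype.sum_prod_type]
  refine Finset.sum_congr rfl fun x _ => Finset.sum_congr rfl fun f _ => ?_
  have h : List.ofFn (Fin.consEquiv (fun _ => A × Bool) (x, f)) = x :: List.ofFn f :=
    List.ofFn_cons x f
  refine if_congr ?_ rfl rfl
  rw [h, wordVal_cons, mul_smul, letterVal_letterInv, eq_inv_smul_iff]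

theorem finite_support_wordCount (n : ℕ) : (Function.support (wordCount π o n)).Finite := by
  refine (Set.finite_range fun f : Fin n → A × Bool => wordVal π (List.ofFn f) • o).subset ?_
  intro v hv
  by_contra h
  refine hv (Finset.sum_eq_zero fun f _ => if_neg fun hf => h ⟨f, hf⟩)

/-- Words that fix a point are exponentially rare if the action expands. -/
theorem Expands.exists_wordCount_le {ε : ℝ} (hs : Expands V (letterVal π) ε) (hε : 0 < ε)
    (hX : 0 < Fintype.card (A × Bool)) :
    ∃ r : ℝ, 0 < r ∧ r < 1 ∧ ∀ n, (wordCount π o n o : ℝ) ≤ r ^ n * Fintype.card (A × Bool) ^ n := by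
  classical
  obtain ⟨κ, hκ0, hκ1, h⟩ := hs.exists_sum_sq_le hε hX (letterInv A) (letterVal_letterInv π)
  refine ⟨√κ, Real.sqrt_pos.2 hκ0, by rw [Real.sqrt_lt' one_pos]; simpa, fun n => ?_⟩
  -- A single finite set carries all iterates up to `n`, which reduces the `ℓ²` estimate to finite
  -- sums.
  obtain ⟨W, hW⟩ : ∃ W : Finset V, ∀ k ≤ n, ∀ v ∉ W, wordCount π o k v = 0 := by
    refine ⟨(Finset.range (n + 1)).biUnion fun k => (finite_support_wordCount π o k).toFinset,
      fun k hk v hv => ?_⟩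
    by_contra hne
    exact hv (Finset.mem_biUnion.2 ⟨k, by simpa using Nat.lt_succ_of_le hk, by simpa using hne⟩)
  have hQ : ∀ k ≤ n, ∑ v ∈ W, (wordCount π o k v : ℝ) ^ 2 ≤
      (κ * (Fintype.card (A × Bool) : ℝ) ^ 2) ^ k := by
    intro k hk
    induction k with
    | zero =>
      have : ∀ v, (wordCount π o 0 v : ℝ) ^ 2 = if o = v then 1 else 0 := by
        intro v
        by_cases hv : o = v <;> simp [wordCount, hv]
      simp only [this, pow_zero, Finset.sum_ite_eq]
      split_ifs <;> norm_num
    | succ k ih =>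
      have := h W (wordCount π o k) (hW k (by omega)) fun v hv => by
        rw [← wordCount_succ]; exact hW (k + 1) hk v hv
      simp only [← wordCount_succ] at this
      rw [pow_succ']
      exact this.trans (mul_le_mul_of_nonneg_left (ih (by omega)) (by positivity))
  have ho : (wordCount π o n o : ℝ) ^ 2 ≤ (√κ ^ n * Fintype.card (A × Bool) ^ n) ^ 2 := by
    have e : (√κ ^ n * (Fintype.card (A × Bool) : ℝ) ^ n) ^ 2 =
        (κ * (Fintype.card (A × Bool) : ℝ) ^ 2) ^ n := by
      rw [← mul_pow, ← pow_mul, mul_comm n 2, pow_mul, mul_pow, Real.sq_sqrt hκ0.le]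
    rw [e]
    refine le_trans ?_ (hQ n le_rfl)
    by_cases hoW : o ∈ W
    · exact Finset.single_le_sum (f := fun v => (wordCount π o n v : ℝ) ^ 2)
        (fun v _ => by positivity) hoW
    · rw [hW n le_rfl o hoW]
      simpa using Finset.sum_nonneg fun v (_ : v ∈ W) => sq_nonneg (wordCount π o n v : ℝ)
  exact le_of_sq_le_sq ho (by positivity)

end Counting

/-! ### Averages with respect to length-invariant measures -/

theorem tsum_list_eq {X : Type*} [Fintype X] (F : List X → ℝ≥0∞) :
    ∑' w, F w = ∑' n, ∑ f : Fin n → X, F (List.ofFn f) := by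
  rw [← List.equivSigmaTuple.symm.tsum_eq, ENNReal.tsum_sigma']
  exact tsum_congr fun n => tsum_fintype _

/-- A bound for the averages of `F` over all words of a fixed length bounds the averages of `F` with
respect to all length-invariant measures. -/
theorem LengthInvariant.tsum_mul_le {X : Type*} [Fintype X] [Nonempty X] {μ : PMF (List X)}
    (hμ : LengthInvariant μ) {F : List X → ℝ≥0∞} {c : ℝ≥0∞}
    (hF : ∀ n, ∑ f : Fin n → X, F (List.ofFn f) ≤ c * (Fintype.card X : ℝ≥0∞) ^ n) :
    ∑' w, F w * μ w ≤ c := by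
  obtain ⟨x⟩ := ‹Nonempty X›
  have hm : ∀ (n : ℕ) (f : Fin n → X), μ (List.ofFn f) = μ (List.replicate n x) :=
    fun n f => hμ _ _ (by simp)
  -- The weights of the spheres add up to `1`.
  have h1 : ∑' n, (Fintype.card X : ℝ≥0∞) ^ n * μ (List.replicate n x) = 1 := by
    rw [← μ.tsum_coe, tsum_list_eq]
    refine tsum_congr fun n => ?_
    simp [hm]
  calc ∑' w, F w * μ w = ∑' n, (∑ f : Fin n → X, F (List.ofFn f)) * μ (List.replicate n x) := by
        rw [tsum_list_eq]
        simp only [hm, Finset.sum_mul]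
    _ ≤ ∑' n, c * ((Fintype.card X : ℝ≥0∞) ^ n * μ (List.replicate n x)) := by
        refine ENNReal.tsum_le_tsum fun n => ?_
        rw [← mul_assoc]
        gcongr
        exact hF n
    _ = c := by rw [ENNReal.tsum_mul_left, h1, mul_one]

theorem IsSubexponential.exists_le {g : ℕ → ℝ} (hg : IsSubexponential g) {R : ℝ} (hR : 1 < R) :
    ∃ B : ℝ, 0 ≤ B ∧ ∀ m, g m ≤ B * R ^ m := by
  obtain ⟨B, hB⟩ := (hg R hR).bddAbove_range
  refine ⟨max B 0, le_max_right _ _, fun m => ?_⟩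
  have h : g m / R ^ m ≤ B := hB ⟨m, rfl⟩
  have hR' : 0 < R ^ m := by positivity
  exact (div_le_iff₀ hR').1 (h.trans (le_max_left _ _))

/-- Subexponential functions, even at linearly bounded arguments, grow slower than any given
exponential function. -/
theorem IsSubexponential.exists_le_of_le_mul {g : ℕ → ℝ} (hg : IsSubexponential g) {r : ℝ}
    (hr0 : 0 < r) (hr1 : r < 1) (k : ℕ) :
    ∃ B : ℝ, 0 ≤ B ∧ ∀ m n, m ≤ k * n → g m * r ^ n ≤ B := by
  have hr : 1 < r⁻¹ := (one_lt_inv₀ hr0).2 hr1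
  -- A root of order `k + 1` rather than `k` also covers `k = 0`.
  have hR : 1 < r⁻¹ ^ ((1 : ℝ) / (k + 1 : ℕ)) := Real.one_lt_rpow hr (by positivity)
  set R := r⁻¹ ^ ((1 : ℝ) / (k + 1 : ℕ)) with hRdef
  have hRk : R ^ (k + 1) = r⁻¹ := by
    rw [hRdef, one_div, Real.rpow_inv_natCast_pow (by positivity) (by omega)]
  obtain ⟨B, hB0, hB⟩ := hg.exists_le hR
  refine ⟨B, hB0, fun m n hmn => ?_⟩
  have h1 : R ^ m ≤ r⁻¹ ^ n := by
    rw [← hRk, ← pow_mul]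
    exact pow_le_pow_right₀ hR.le (hmn.trans (by gcongr; omega))
  calc g m * r ^ n ≤ B * r⁻¹ ^ n * r ^ n := by
        gcongr
        exact (hB m).trans (by gcongr)
    _ = B := by rw [mul_assoc, ← mul_pow, inv_mul_cancel₀ hr0.ne', one_pow, mul_one]

/-! ### Rewriting words by transducers -/

section Rewriting

variable {A G : Type*} [Group G]

/-- A subgroup `G₁` of `G` has a Reidemeister–Schreier cocycle `r : G × G ⧸ G₁ → G₁`. -/
theorem exists_schreier_cocycle (G₁ : Subgroup G) :
    ∃ r : G → G ⧸ G₁ → G₁, (∀ g h c, r (g * h) c = r g (h • c) * r h c) ∧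
      ∀ g : G₁, r g ((1 : G) : G ⧸ G₁) = g := by
  classical
  obtain ⟨t, ht, ht1⟩ : ∃ t : G ⧸ G₁ → G, (∀ c, (t c : G ⧸ G₁) = c) ∧
      t ((1 : G) : G ⧸ G₁) = 1 := by
    -- Normalizing the transversal at the trivial coset makes the cocycle the identity on `G₁`
    -- there.
    refine ⟨Function.update Quotient.out ((1 : G) : G ⧸ G₁) 1, fun c => ?_, by simp⟩
    by_cases hc : c = ((1 : G) : G ⧸ G₁)
    · subst hc; simp
    · simp [Function.update_of_ne hc]
  have hmem : ∀ g c, (t (g • c))⁻¹ * (g * t c) ∈ G₁ := by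
    intro g c
    refine QuotientGroup.eq.1 ?_
    rw [ht]
    exact congrArg (g • ·) (ht c).symm
  refine ⟨fun g c => ⟨_, hmem g c⟩, fun g h c => ?_, fun g => ?_⟩
  · ext
    simp [mul_smul, mul_assoc]
  · ext
    have : (g : G) • ((1 : G) : G ⧸ G₁) = ((1 : G) : G ⧸ G₁) := by
      refine (QuotientGroup.eq (s := G₁)).2 ?_
      simp
    simp [this, ht1]

/-- A transducer that follows the action of `G` on a set `Q` computes the values of a cocycle. -/
theorem transduce_cocycle {Q S B Γ : Type*} [MulAction G Q] [Group Γ] (π : A → G) {r : G → Q → Γ}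
    (hr : ∀ g h c, r (g * h) c = r g (h • c) * r h c) (e : Q ≃ S) (ρ : B → Γ)
    {out : A × Bool → S → List (B × Bool)}
    (hout : ∀ x c, wordVal ρ (out x (e c)) = r (letterVal π x) c) (q : Q)
    (w : List (A × Bool)) :
    (transduce (fun x s => e (letterVal π x • e.symm s)) out (e q) w).1 = e (wordVal π w • q) ∧
      wordVal ρ (transduce (fun x s => e (letterVal π x • e.symm s)) out (e q) w).2 =
        r (wordVal π w) q := by
  induction w with
  | nil =>
    have h1 := hr 1 1 q
    rw [one_mul, one_smul, left_eq_mul] at h1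
    simp [transduce, h1]
  | cons x w ih => simp [transduce, ih.1, ih.2, hout, hr, mul_smul]

end Rewriting

/-! ### Average-case complexity of the membership problem -/

theorem theoremC {G Gbar : Type*} [Group G] [Group.IsFinitelyPresented G] [Group Gbar]
    (𝓒 : TimeClass) (h𝓒 : 𝓒.SubsetSubExp)
    (H G₁ : Subgroup G) (hH : MembershipInSubExp H)
    (hG₁ : G₁.FiniteIndex) (hHG₁ : H ≤ G₁)
    (φ : G₁ →* Gbar) (hφ : Function.Surjective φ)
    (K : Subgroup Gbar) (hHK : (H.subgroupOf G₁).map φ ≤ K)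
    (hKna : HasNonamenableSchreierGraph K) (hK : MembershipIn 𝓒 K)
    {A : Type*} [Finite A] (π : A → G) (hπ : Generates π) :
    𝓒.ContainsOnAverage (membershipProblem π H)
      {μ : PMF (List (A × Bool)) | LengthInvariant μ} := by
  classical
  have := Fintype.ofFinite A
  have := Fintype.ofFinite (G ⧸ G₁)
  set P : Subgroup G := (K.comap φ).map G₁.subtype with hP
  obtain ⟨ε, hε, hexp⟩ : ∃ ε : ℝ, 0 < ε ∧ Expands (G ⧸ P) (letterVal π) ε := by
    obtain ⟨n, πB, -, hna⟩ := hKna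
    obtain ⟨ε, hε, h⟩ := hna.exists_expands
    obtain ⟨s', h'⟩ := h.of_finiteIndex hφ
    exact h'.of_generates hε hπ
  -- An empty family cannot move a one-point set off itself.
  have hX : 0 < Fintype.card (A × Bool) := by
    by_contra h0
    have : IsEmpty (A × Bool) := Fintype.card_eq_zero_iff.1 (by omega)
    have := hexp {((1 : G) : G ⧸ P)}
    simp only [Finset.card_singleton, Finset.univ_eq_empty, Finset.sum_empty] at this
    norm_num at this
    linarith
  have hne : Nonempty (A × Bool) := Fintype.card_pos_iff.1 hX
  obtain ⟨ρ, hρ0, hρ1, hcount⟩ := hexp.exists_wordCount_le π ((1 : G) : G ⧸ P) hε hX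
  obtain ⟨nK, πK, hπK, fK, hfK, MK, hMK, htK⟩ := hK
  obtain ⟨nH, πH, hπH, gH, hgH, MH, hMH, htH⟩ := hH
  obtain ⟨r, hr, hr1⟩ := exists_schreier_cocycle G₁
  choose wK hwK using hπK.exists_wordVal_eq
  choose wH hwH using hπH.exists_wordVal_eq
  -- Cosets are numbered because the transducer needs states in `Type`.
  let e := Fintype.equivFin (G ⧸ G₁)
  let next : A × Bool → Fin (Fintype.card (G ⧸ G₁)) → Fin (Fintype.card (G ⧸ G₁)) :=
    fun x s => e (letterVal π x • e.symm s)
  let o : G ⧸ G₁ := (1 : G)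
  let outK : A × Bool → Fin (Fintype.card (G ⧸ G₁)) → List (Fin nK × Bool) :=
    fun x s => wK (φ (r (letterVal π x) (e.symm s)))
  let outH : A × Bool → Fin (Fintype.card (G ⧸ G₁)) → List (Fin nH × Bool) :=
    fun x _ => wH (letterVal π x)
  have hTK := transduce_cocycle π (r := fun g c => φ (r g c)) (fun g h c => by rw [hr, map_mul]) e
    πK (out := outK) (fun x c => by simp [outK, hwK]) o
  have hTH := transduce_cocycle π (r := fun g (_ : G ⧸ G₁) => g) (fun g h c => rfl) e
    πH (out := outH) (fun x c => hwH _) o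
  obtain ⟨N, k, hdec, hlenK, hlenH, htime, htime'⟩ :=
    exists_machine_transduce hMK hMH (e o) next outK outH (fun s => s = e o)
  have ho : ∀ g : G, g • o = o ↔ g ∈ G₁ := by
    intro g
    change ((g * 1 : G) : G ⧸ G₁) = ((1 : G) : G ⧸ G₁) ↔ _
    rw [eq_comm, QuotientGroup.eq]
    simp
  have hacc : ∀ w, ((transduce next outK (e o) w).1 = e o ∧
      (transduce next outK (e o) w).2 ∈ membershipProblem πK K) ↔ wordVal π w ∈ P := by
    intro w
    change _ ∧ wordVal πK _ ∈ K ↔ _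
    rw [(hTK w).1, (hTK w).2, e.apply_eq_iff_eq, ho, hP]
    constructor
    · rintro ⟨h1, h2⟩
      exact ⟨⟨_, h1⟩, by rw [← hr1 ⟨_, h1⟩]; exact h2, rfl⟩
    · rintro ⟨g, hg, h⟩
      change (g : G) = wordVal π w at h
      rw [← h]
      refine ⟨g.2, ?_⟩
      rw [hr1]
      exact hg
  have hHP : H ≤ P := fun g hg =>
    ⟨⟨g, hHG₁ hg⟩, hHK ⟨⟨g, hHG₁ hg⟩, hg, rfl⟩, rfl⟩
  obtain ⟨B, hB0, hB⟩ := hgH.exists_le_of_le_mul hρ0 hρ1 k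
  -- Of the `k + 2` copies of `fK`, one pays for the linear overhead, by `le_apply`, and one for the
  -- run on the rewritten word; the additive constant makes the bound positive.
  refine ⟨N, _, 𝓒.closed fK hfK (k + 2) (by omega), ?_, ?_, fun n => by positivity,
    1 + B.toNNReal, by positivity, fun μ hμ => ?_⟩
  · intro w
    obtain ⟨t, b, h, hb⟩ := hdec w
    refine ⟨t, b, h, hb.trans ?_⟩
    change _ ∧ _ ∧ wordVal πH _ ∈ H ↔ wordVal π w ∈ H
    rw [(hTH w).2, ← and_assoc, hacc]
    -- The preliminary test does not change the language, since `H ≤ P`.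
    exact and_iff_right_of_imp fun h => hHP h
  · intro m n hmn
    have := 𝓒.monotone fK hfK (show (k + 2) * m + (k + 2) ≤ (k + 2) * n + (k + 2) by gcongr)
    dsimp only
    gcongr
  · set f : ℕ → ℕ := fun n => (k + 2) * fK ((k + 2) * n + (k + 2)) + (k + 2) with hf
    have hbase : ∀ w : List (A × Bool), k * (w.length + 1) +
        fK (transduce next outK (e o) w).2.length ≤ f w.length := by
      intro w
      have h1 := 𝓒.le_apply fK hfK ((k + 2) * w.length + (k + 2))
      have h2 := 𝓒.monotone fK hfK (show (transduce next outK (e o) w).2.length ≤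
        (k + 2) * w.length + (k + 2) from (hlenK w).trans (by nlinarith))
      have h3 : 2 * fK ((k + 2) * w.length + (k + 2)) ≤
        (k + 2) * fK ((k + 2) * w.length + (k + 2)) := by gcongr; omega
      simp only [hf]
      nlinarith
    -- The `1` covers the test for `P`; the other term covers the run for `H` and is present only on
    -- `P`, where its size `ρ⁻¹ ^ n` is cancelled by the rarity of such words.
    let F : List (A × Bool) → ℝ≥0∞ := fun w => 1 +
      if wordVal π w • ((1 : G) : G ⧸ P) = ((1 : G) : G ⧸ P) then
        ENNReal.ofReal (B * ρ⁻¹ ^ w.length) else 0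
    have hPo : ∀ g : G, g • ((1 : G) : G ⧸ P) = ((1 : G) : G ⧸ P) ↔ g ∈ P := by
      intro g
      change ((g * 1 : G) : G ⧸ P) = ((1 : G) : G ⧸ P) ↔ _
      rw [eq_comm, QuotientGroup.eq]
      simp
    have hTF : ∀ w, (N.time w : ℝ≥0∞) / (f w.length : ℝ≥0∞) ≤ F w := by
      intro w
      have hf1 : 1 ≤ f w.length := by simp only [hf]; omega
      refine ENNReal.div_le_of_le_mul ?_
      by_cases hw : wordVal π w ∈ P
      · have h1 : N.time w ≤ ((f w.length + gH (transduce next outH (e o) w).2.length : ℕ) : ℕ∞) := by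
          refine (htime w).trans ?_
          refine (add_le_add (add_le_add le_rfl (htK _)) (htH _)).trans ?_
          exact_mod_cast Nat.add_le_add_right (hbase w) _
        have h2 : (gH (transduce next outH (e o) w).2.length : ℝ) ≤ B * ρ⁻¹ ^ w.length := by
          have := hB _ _ (hlenH w)
          rw [inv_pow, ← div_eq_mul_inv]
          exact (le_div_iff₀ (by positivity)).2 this
        have h3 : (N.time w : ℝ≥0∞) ≤
            f w.length + gH (transduce next outH (e o) w).2.length := by
          have := ENat.toENNReal_le.2 h1
          simpa using this
        simp only [F, hPo, hw, if_true, add_mul, one_mul]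
        refine h3.trans (add_le_add le_rfl ?_)
        calc (gH (transduce next outH (e o) w).2.length : ℝ≥0∞)
            = ENNReal.ofReal (gH (transduce next outH (e o) w).2.length : ℝ) := by simp
          _ ≤ ENNReal.ofReal (B * ρ⁻¹ ^ w.length) := ENNReal.ofReal_le_ofReal h2
          _ ≤ _ := le_mul_of_one_le_right' (by exact_mod_cast hf1)
      · have h1 : N.time w ≤ ((f w.length : ℕ) : ℕ∞) := by
          refine (htime' w (by rwa [hacc])).trans ?_
          refine (add_le_add le_rfl (htK _)).trans ?_
          exact_mod_cast hbase w
        have h3 : (N.time w : ℝ≥0∞) ≤ f w.length := by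
          have := ENat.toENNReal_le.2 h1
          simpa using this
        simp only [F, hPo, hw, if_false, add_zero, one_mul]
        exact h3
    refine (ENNReal.tsum_le_tsum fun w => mul_le_mul_left (hTF w) _).trans ?_
    refine LengthInvariant.tsum_mul_le hμ fun n => ?_
    have hsum : ∑ f : Fin n → A × Bool, F (List.ofFn f) =
        (Fintype.card (A × Bool) : ℝ≥0∞) ^ n +
          wordCount π ((1 : G) : G ⧸ P) n ((1 : G) : G ⧸ P) * ENNReal.ofReal (B * ρ⁻¹ ^ n) := by
      simp only [F, Finset.sum_add_distrib, wordCount, List.length_ofFn]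
      congr 1
      · simp
      · push_cast
        rw [Finset.sum_mul]
        refine Finset.sum_congr rfl fun f _ => ?_
        split_ifs <;> simp
    rw [hsum]
    have h4 : (wordCount π ((1 : G) : G ⧸ P) n ((1 : G) : G ⧸ P) : ℝ≥0∞) *
        ENNReal.ofReal (B * ρ⁻¹ ^ n) ≤ ENNReal.ofReal (B * (Fintype.card (A × Bool) : ℝ) ^ n) := by
      rw [← ENNReal.ofReal_natCast, ← ENNReal.ofReal_mul (by positivity)]
      refine ENNReal.ofReal_le_ofReal ?_
      calc _ ≤ ρ ^ n * (Fintype.card (A × Bool) : ℝ) ^ n * (B * ρ⁻¹ ^ n) := by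
            gcongr
            exact hcount n
        _ = B * (Fintype.card (A × Bool) : ℝ) ^ n := by
            rw [inv_pow]
            field_simp
    refine (add_le_add le_rfl h4).trans (le_of_eq ?_)
    rw [ENNReal.ofReal_mul hB0, ENNReal.ofReal_pow (by positivity), ENNReal.ofReal_natCast,
      ENNReal.coe_add, ENNReal.coe_one, add_mul, one_mul]
    rfl
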